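/- Let $0<\mu<L$ and let $f:\mathbb R^d\to\mathbb R$ be $\mu$-strongly convex and continuously differentiable with $L$-Lipschitz gradient; let $x_*$ be its minimizer and $f_*=f(x_*)$. Let $\alpha\in(0,1/L]$ and $\beta=\nu=\frac{1-\sqrt{\alpha\mu}}{1+\sqrt{\alpha\mu}}$, and consider Nesterov's accelerated gradient method with noisy gradients, started at a deterministic $x_0=x_{-1}\in\mathbb R^d$: for $k\ge 0$, $$y_k=x_k+\nu(x_k-x_{k-1}),\qquad x_{k+1}=x_k-\alpha\bigl(\nabla f(y_k)+w_{k+1}\bigr)+\beta(x_k-x_{k-1}).$$ Let $\mathcal F_k=\sigma(x_0,\dots,x_k)$. Assume that the random vectors $w_{k+1}$ are $\mathcal F_{k+1}$-measurable and that, for some $\sigma>0$, $\mathbb P(\|w_{k+1}\|\ge t\mid\mathcal F_k)\le 2e^{-t^2/(2\sigma^2)}$ almost surely for all $t\ge0$ and $k\ge0$ (the noise may be biased). For $K\ge1$ and $\theta>0$ let $$R_K(\theta)=\frac{2\sigma^2}{(K+1)\theta}\log\mathbb E\Bigl[e^{\frac{\theta}{2\sigma^2}S_K}\Bigr],\qquad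 S_K=\sum_{k=0}^K[f(x_k)-f_*].$$ Put $$s_1=\frac{2(5-2\sqrt{\alpha\mu}+\alpha\mu)\sqrt\alpha}{\sqrt\mu(1+\sqrt{\alpha\mu})^2},\qquad s_2=\frac{8L^3\alpha\sqrt\alpha}{\mu\sqrt\mu(1+\sqrt{\alpha\mu})^2}\bigl(4+(1-\sqrt{\alpha\mu})^2\bigr),$$ $$p=\bigl[1-\sqrt{\alpha\mu}\bigr]+\frac{2}{s_1}\,\frac{\alpha}{4(1+\sqrt{\alpha\mu})^2}+\frac{2}{\mu s_1}\,\frac{\alpha^2\mu^2+2\alpha\mu+\alpha\mu(1-\sqrt{\alpha\mu})}{4(1+\sqrt{\alpha\mu})^2}+\frac{4L^3\alpha^2}{2\mu s_2}(1+\nu)^2,$$ $$q=\frac{2}{s_1}\,\frac{\alpha(1-\sqrt{\alpha\mu})}{4(1+\sqrt{\alpha\mu})^2}+\frac{4L^3\alpha^2\nu^2}{2\mu s_2},\qquad r=s_1+\frac{L\alpha^2(2+s_2)}{2s_2}+\frac\alpha2,\qquad c_1=1,$$ $$\tilde P=\frac1{2\alpha}\begin{bmatrix}1\\-(1-\sqrt{\alpha\mu})\end{bmatrix}\begin{bmatrix}1&-(1-\sqrt{\alpha\mu})\end{bmatrix},\qquad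 \tilde r(\tilde P)=\begin{cases}\tilde P_{11}-\tilde P_{12}^2/\tilde P_{22}&\text{if }\tilde P_{22}\ne0,\\ \tilde P_{11}&\text{if }\tilde P_{22}=0,\end{cases}$$ and $$c=c_1+\tfrac2L\tilde r(\tilde P),\qquad \lambda_+=\frac{p+\sqrt{p^2+4q}}2,\qquad J_{p,q}=\frac1{1+\lambda_+-p},\qquad \overline H_\infty=\Bigl(\frac{1}{1-(p+q)}\,\frac rc\Bigr)^{1/2},$$ $$V_0=c_1[f(x_0)-f_*]+\begin{bmatrix}x_0-x_*\\x_0-x_*\end{bmatrix}^\top(\tilde P\otimes \mathsf I_d)\begin{bmatrix}x_0-x_*\\x_0-x_*\end{bmatrix},\qquad a_{j,K}=\frac{1-\lambda_+^{K-j+1}}{1-(p+q)}\quad(1\le j\le K),$$ $$\hat c(K,\theta)=\begin{cases}\dfrac{2\sigma^2c}{\theta}\displaystyle\sum_{j=1}^K\log\frac{c+r\theta a_{j,K}}{c-r\theta a_{j,K}}&\text{if }\sqrt\theta\,\overline H_\infty<1,\\+\infty&\text{otherwise,}\end{cases}\qquad \bar c(K,\theta)=\Bigl(\frac{1-\lambda_+^{K+1}}{1-\lambda_+}-1+J_{p,q}\Bigr)V_0+\hat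 c(K,\theta).$$ Then $\tilde P\succeq0$, $\tilde r(\tilde P)=0$, $p,q\ge0$, $p+q<1$, $\lambda_+\in[0,1)$, $J_{p,q}\in(0,1]$, and for every $K\ge1$ and every $\theta>0$, $$R_K(\theta)\le\overline R_K(\theta):=\begin{cases}\dfrac{1}{c\,(K+1)}\min\Bigl\{\dfrac1{J_{p,q}}\,\bar c\Bigl(K,\dfrac{\theta}{J_{p,q}}\Bigr),\ \bar c(K+1,\theta)\Bigr\}&\text{if }\sqrt\theta\,\overline H_\infty<1,\\+\infty&\text{otherwise.}\end{cases}$$ -/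

import Mathlib

open MeasureTheory

noncomputable section

namespace GMM

/-- The class of `μ`-strongly convex, `L`-smooth functions on `ℝ^d`. -/
structure StronglyConvexSmooth {d : ℕ} (μ L : ℝ) (f : EuclideanSpace ℝ (Fin d) → ℝ) : Prop where
  strongConvex : StrongConvexOn Set.univ μ f
  contDiff : ContDiff ℝ 1 f
  smooth : ∀ x y, ‖gradient f x - gradient f y‖ ≤ L * ‖x - y‖

/-- The pair `(x_k, x_{k-1})` produced by the generalized momentum method with parameters
`(α, β, ν)` from `x_0 = x_{-1}`:
`y_k = x_k + ν (x_k - x_{k-1})`,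
`x_{k+1} = x_k - α (∇f(y_k) + w_{k+1}) + β (x_k - x_{k-1})`.
The noise of step `k` is `w (k + 1)`; the entry `w 0` is never used. -/
def state {d : ℕ} (f : EuclideanSpace ℝ (Fin d) → ℝ) (α β ν : ℝ)
    (x₀ : EuclideanSpace ℝ (Fin d)) (w : ℕ → EuclideanSpace ℝ (Fin d)) :
    ℕ → EuclideanSpace ℝ (Fin d) × EuclideanSpace ℝ (Fin d)
  | 0 => (x₀, x₀)
  | k + 1 =>
    let x := (state f α β ν x₀ w k).1
    let xprev := (state f α β ν x₀ w k).2
    let y := x + ν • (x - xprev)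
    (x - α • (gradient f y + w (k + 1)) + β • (x - xprev), x)

/-- The random iterate `x_k`. -/
def iterate {d : ℕ} {Ω : Type*} (f : EuclideanSpace ℝ (Fin d) → ℝ) (α β ν : ℝ)
    (x₀ : EuclideanSpace ℝ (Fin d)) (w : ℕ → Ω → EuclideanSpace ℝ (Fin d))
    (k : ℕ) (ω : Ω) : EuclideanSpace ℝ (Fin d) :=
  (state f α β ν x₀ (fun j => w j ω) k).1

/-- The `σ`-algebra `F_k` generated by the iterates `x_0, …, x_k`. -/
abbrev iterateSigma {d : ℕ} {Ω : Type*} (f : EuclideanSpace ℝ (Fin d) → ℝ) (α β ν : ℝ)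
    (x₀ : EuclideanSpace ℝ (Fin d)) (w : ℕ → Ω → EuclideanSpace ℝ (Fin d))
    (k : ℕ) : MeasurableSpace Ω :=
  ⨆ j ∈ Finset.range (k + 1),
    MeasurableSpace.comap (iterate f α β ν x₀ w j) inferInstance

/-- The gradient noise `w_{k+1}` is a random vector, is `F_{k+1}`-measurable, and, conditionally
on `F_k`, has a sub-Gaussian norm with variance proxy `σ²`. It may be biased. -/
structure SubGaussianNoise {d : ℕ} {Ω : Type*} [MeasurableSpace Ω] (P : Measure Ω)
    (f : EuclideanSpace ℝ (Fin d) → ℝ) (α β ν : ℝ)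
    (x₀ : EuclideanSpace ℝ (Fin d)) (w : ℕ → Ω → EuclideanSpace ℝ (Fin d)) (σ : ℝ) : Prop where
  measurable : ∀ k, Measurable (w (k + 1))
  adapted : ∀ k, Measurable[iterateSigma f α β ν x₀ w (k + 1)] (w (k + 1))
  tail : ∀ k : ℕ, ∀ t : ℝ, 0 ≤ t →
    condExp (iterateSigma f α β ν x₀ w k) P
        (Set.indicator {ω | t ≤ ‖w (k + 1) ω‖} (fun _ => (1 : ℝ)))
      ≤ᵐ[P] fun _ => 2 * Real.exp (-t ^ 2 / (2 * σ ^ 2))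

/-- The cumulative suboptimality `S_K = ∑_{k=0}^K (f(x_k) - f_*)`, where `f_* = f(x_*)`. -/
def cumulativeCost {d : ℕ} {Ω : Type*} (f : EuclideanSpace ℝ (Fin d) → ℝ) (α β ν : ℝ)
    (x₀ xs : EuclideanSpace ℝ (Fin d)) (w : ℕ → Ω → EuclideanSpace ℝ (Fin d))
    (K : ℕ) (ω : Ω) : ℝ :=
  ∑ k ∈ Finset.range (K + 1), (f (iterate f α β ν x₀ w k ω) - f xs)

/-- The risk-sensitive cost
`R_K(θ) = 2σ² / ((K+1) θ) · log E[exp (θ / (2σ²) · S_K)]`,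
with values in the extended reals: it is `⊤` if the expectation is infinite. -/
def riskCost {d : ℕ} {Ω : Type*} [MeasurableSpace Ω] (P : Measure Ω)
    (f : EuclideanSpace ℝ (Fin d) → ℝ) (α β ν : ℝ)
    (x₀ xs : EuclideanSpace ℝ (Fin d)) (w : ℕ → Ω → EuclideanSpace ℝ (Fin d))
    (σ : ℝ) (K : ℕ) (θ : ℝ) : EReal :=
  ((2 * σ ^ 2 / ((K + 1 : ℝ) * θ) : ℝ) : EReal) *
    ENNReal.log (∫⁻ ω, ENNReal.ofReal
      (Real.exp (θ / (2 * σ ^ 2) * cumulativeCost f α β ν x₀ xs w K ω)) ∂P)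

/-- The Lyapunov function `V_{P,c₁}(ξ)` at `ξ = (x, x')`, for `P = Pt ⊗ I_d`: the quadratic form
of `Pt ⊗ I_d` at the stacked vector with blocks `x - x_*` and `x' - x_*` is
`∑ i j, Pt i j * ⟪block i, block j⟫`. -/
def lyapunov {d : ℕ} (f : EuclideanSpace ℝ (Fin d) → ℝ) (xs : EuclideanSpace ℝ (Fin d))
    (c₁ : ℝ) (Pt : Matrix (Fin 2) (Fin 2) ℝ)
    (ξ : EuclideanSpace ℝ (Fin d) × EuclideanSpace ℝ (Fin d)) : ℝ :=
  c₁ * (f ξ.1 - f xs) +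
    ∑ i : Fin 2, ∑ j : Fin 2,
      Pt i j * inner ℝ ((![ξ.1 - xs, ξ.2 - xs] : Fin 2 → EuclideanSpace ℝ (Fin d)) i)
        ((![ξ.1 - xs, ξ.2 - xs] : Fin 2 → EuclideanSpace ℝ (Fin d)) j)

/-- `r̃(Pt)`: the Schur complement of the lower right entry (the upper left entry if the lower
right entry vanishes). -/
def rTilde (Pt : Matrix (Fin 2) (Fin 2) ℝ) : ℝ :=
  if Pt 1 1 ≠ 0 then Pt 0 0 - Pt 0 1 ^ 2 / Pt 1 1 else Pt 0 0

/-- `λ₊ = (p + √(p² + 4q)) / 2`. -/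
def lambdaPlus (p q : ℝ) : ℝ := (p + √(p ^ 2 + 4 * q)) / 2

/-- `J_{p,q} = 1 / (1 + λ₊ - p)`. -/
def J (p q : ℝ) : ℝ := 1 / (1 + lambdaPlus p q - p)

/-- `H̄_∞ = (1 / (1 - (p+q)) · r / c)^{1/2}`. Here and below `c` stands for
`c₁ + (2/L) r̃(Pt)`. -/
def hInfBar (p q r c : ℝ) : ℝ := √(1 / (1 - (p + q)) * (r / c))

/-- `a_{j,K} = (1 - λ₊^{K-j+1}) / (1 - (p+q))`, for `1 ≤ j ≤ K`. -/
def aCoef (p q : ℝ) (j K : ℕ) : ℝ :=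
  (1 - lambdaPlus p q ^ (K - j + 1)) / (1 - (p + q))

open Classical in
/-- `ĉ(K,θ)`. -/
def cHat (p q r c σ : ℝ) (K : ℕ) (θ : ℝ) : EReal :=
  if √θ * hInfBar p q r c < 1 then
    ((2 * σ ^ 2 * c / θ * ∑ j ∈ Finset.Icc 1 K,
      Real.log ((c + r * θ * aCoef p q j K) / (c - r * θ * aCoef p q j K)) : ℝ) : EReal)
  else ⊤

/-- `c̄(K,θ)`, where `V₀ = V_{P,c₁}(ξ_0)`. -/
def cBar (p q r c σ V₀ : ℝ) (K : ℕ) (θ : ℝ) : EReal :=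
  ((((1 - lambdaPlus p q ^ (K + 1)) / (1 - lambdaPlus p q) - 1 + J p q) * V₀ : ℝ) : EReal) +
    cHat p q r c σ K θ

open Classical in
/-- The finite-time risk bound `R̄_K(θ)` with constants `p, q, r, c₁, Pt`. -/
def riskBound (L p q r c₁ : ℝ) (Pt : Matrix (Fin 2) (Fin 2) ℝ) (σ V₀ : ℝ)
    (K : ℕ) (θ : ℝ) : EReal :=
  let c := c₁ + 2 / L * rTilde Pt
  if √θ * hInfBar p q r c < 1 then
    ((1 / (c * (K + 1 : ℝ)) : ℝ) : EReal) *
      min (((1 / J p q : ℝ) : EReal) * cBar p q r c σ V₀ K (θ / J p q))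
        (cBar p q r c σ V₀ (K + 1) θ)
  else ⊤

/-- The standard momentum parameter `(1 - √(αμ)) / (1 + √(αμ))` of Nesterov's method. -/
def nagNu (α μ : ℝ) : ℝ := (1 - √(α * μ)) / (1 + √(α * μ))

def nagS1 (α μ : ℝ) : ℝ :=
  2 * (5 - 2 * √(α * μ) + α * μ) * √α / (√μ * (1 + √(α * μ)) ^ 2)

def nagS2 (α μ L : ℝ) : ℝ :=
  8 * L ^ 3 * α * √α / (μ * √μ * (1 + √(α * μ)) ^ 2) * (4 + (1 - √(α * μ)) ^ 2)

def nagP (α μ L : ℝ) : ℝ :=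
  (1 - √(α * μ)) +
  2 / nagS1 α μ * (α / (4 * (1 + √(α * μ)) ^ 2)) +
  2 / (μ * nagS1 α μ) *
    ((α ^ 2 * μ ^ 2 + 2 * α * μ + α * μ * (1 - √(α * μ))) / (4 * (1 + √(α * μ)) ^ 2)) +
  4 * L ^ 3 * α ^ 2 / (2 * μ * nagS2 α μ L) * (1 + nagNu α μ) ^ 2

def nagQ (α μ L : ℝ) : ℝ :=
  2 / nagS1 α μ * (α * (1 - √(α * μ)) / (4 * (1 + √(α * μ)) ^ 2)) +
  4 * L ^ 3 * α ^ 2 * nagNu α μ ^ 2 / (2 * μ * nagS2 α μ L)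

def nagR (α μ L : ℝ) : ℝ :=
  nagS1 α μ + L * α ^ 2 * (2 + nagS2 α μ L) / (2 * nagS2 α μ L) + α / 2

/-- The matrix `(1 / (2α)) v vᵀ` with `v = (1, -(1 - √(αμ)))`. -/
def nagPt (α μ : ℝ) : Matrix (Fin 2) (Fin 2) ℝ :=
  (1 / (2 * α)) • Matrix.vecMulVec ![1, -(1 - √(α * μ))] ![1, -(1 - √(α * μ))]

end GMM

end

/-!
Write `s = √(α μ)`, `z k = (x k - x_*) - (1 - s) (x (k - 1) - x_*)`. The matrix `nagPt` has rank
one, so that the Lyapunov function is `V k = f (x k) - f_* + ‖z k‖² / (2 α)`, and everything rests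
on the pathwise inequality `V (k + 1) ≤ p V k + r ‖w (k + 1)‖²` (`GMM.lyapunov_state_succ_le`).

To obtain it, the descent lemma and strong convexity are used at the extrapolated point `y k`
(`GMM.lyapunov_step_le`). They give the contraction factor `1 - s`, a multiple of
`‖w (k + 1)‖²`, and a cross term `⟪n, w (k + 1)⟫ / (1 + s)`, where `n` combines
`z k`, `x k - x_*` and the gradient at `y k`. Cocoercivity of the gradient together with strong
convexity bounds `‖n‖²` by `15 α V k` (`GMM.norm_noise_direction_sq_le`), and Young's
inequality with weight `s₁` distributes the cross term between `V k` and `‖w (k + 1)‖²`. The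
constants leave room for this, because `p` and `q` are functions of `s` alone (`GMM.nagP_eq`, `GMM.nagQ_eq`), with `p + q = 1 - s / 2`.

As `q ≥ 0` and `V ≥ 0`, also `V (k + 1) ≤ p V k + q V (k - 1) + r ‖w (k + 1)‖²`. Since
`q = λ₊ (λ₊ - p)`, the potential `V k + (λ₊ - p) V (k - 1)` contracts with the factor `λ₊`.
Summing it up to time `K`, or up to time `K + 1`, bounds `∑ V k` by a multiple of `V 0` plus a
weighted sum of the `‖w j‖²` in two ways (`GMM.sum_lyapunov_le`, `GMM.sum_lyapunov_le'`); these
are the two terms of the minimum in the risk bound.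

Finally, the conditional sub-Gaussian tail and the layer cake formula give
`E[exp (τ ‖w (k + 1)‖²) | F_k] ≤ (1 + 2 σ² τ) / (1 - 2 σ² τ)` for `0 ≤ τ < 1 / (2 σ²)`, hence a
product bound for the joint exponential moment (`GMM.SubGaussianNoise.lintegral_exp_sum_le`).
-/

namespace GMM

/-! ### Strongly convex functions with Lipschitz gradient -/

section Smooth

variable {E : Type*} [NormedAddCommGroup E] [InnerProductSpace ℝ E] [CompleteSpace E]
  {f : E → ℝ} {μ L : ℝ}

theorem hasDerivAt_comp_line (hf : Differentiable ℝ f) (x v : E) (t : ℝ) :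
    HasDerivAt (fun t : ℝ => f (x + t • v)) (inner ℝ (gradient f (x + t • v)) v) t := by
  have h1 : HasDerivAt (fun t : ℝ => x + t • v) v t := by
    simpa using ((hasDerivAt_id t).smul_const v).const_add x
  have h2 := (hf (x + t • v)).hasFDerivAt.comp_hasDerivAt t h1
  rw [inner_gradient_left]
  exact h2

/-- First-order form of strong convexity: the limit of the defining inequality, divided by `t`,
along the segment from `x` to `y`. -/
theorem _root_.StrongConvexOn.add_inner_gradient_le (hc : StrongConvexOn Set.univ μ f)
    (hf : Differentiable ℝ f) (x y : E) :
    f x + inner ℝ (gradient f x) (y - x) + μ / 2 * ‖y - x‖ ^ 2 ≤ f y := by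
  have hd := hasDerivAt_comp_line hf x (y - x) 0
  rw [hasDerivAt_iff_tendsto_slope] at hd
  have hd' := hd.mono_left (nhdsWithin_mono 0 (fun t (ht : t ∈ Set.Ioi (0 : ℝ)) => ht.ne'))
  have hlim : Filter.Tendsto (fun t : ℝ => f y - f x - (1 - t) * (μ / 2 * ‖y - x‖ ^ 2))
      (nhdsWithin 0 (Set.Ioi 0)) (nhds (f y - f x - (1 - 0) * (μ / 2 * ‖y - x‖ ^ 2))) := by
    refine Filter.Tendsto.mono_left ?_ nhdsWithin_le_nhds
    exact Continuous.tendsto (by fun_prop) 0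
  have hle : ∀ᶠ t : ℝ in nhdsWithin 0 (Set.Ioi 0),
      slope (fun t : ℝ => f (x + t • (y - x))) 0 t
        ≤ f y - f x - (1 - t) * (μ / 2 * ‖y - x‖ ^ 2) := by
    filter_upwards [Ioo_mem_nhdsGT (zero_lt_one' ℝ)] with t ht
    have h := hc.2 (Set.mem_univ x) (Set.mem_univ y) (sub_nonneg.2 ht.2.le) ht.1.le
      (sub_add_cancel 1 t)
    have he : (1 - t) • x + t • y = x + t • (y - x) := by module
    rw [he, norm_sub_rev x y] at h
    rw [slope_def_field]
    simp only [zero_smul, add_zero, sub_zero]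
    rw [div_le_iff₀ ht.1]
    simp only [smul_eq_mul] at h
    linarith
  have := le_of_tendsto_of_tendsto hd' hlim hle
  simp only [zero_smul, add_zero, sub_zero, one_mul] at this
  linarith

/-- The descent lemma for functions with Lipschitz gradient. -/
theorem le_add_inner_gradient (hf : Differentiable ℝ f)
    (hL : ∀ x y, ‖gradient f x - gradient f y‖ ≤ L * ‖x - y‖) (x y : E) :
    f y ≤ f x + inner ℝ (gradient f x) (y - x) + L / 2 * ‖y - x‖ ^ 2 := by
  set v := y - x with hv
  let φ : ℝ → ℝ := fun t =>
    f (x + t • v) - t * inner ℝ (gradient f x) v - L / 2 * ‖v‖ ^ 2 * t ^ 2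
  have hφ : ∀ t, HasDerivAt φ
      (inner ℝ (gradient f (x + t • v)) v - inner ℝ (gradient f x) v - L * ‖v‖ ^ 2 * t) t := by
    intro t
    have h1 := hasDerivAt_comp_line hf x v t
    have h2 := (hasDerivAt_id t).mul_const (inner ℝ (gradient f x) v)
    have h3 := (hasDerivAt_pow 2 t).const_mul (L / 2 * ‖v‖ ^ 2)
    refine ((h1.sub h2).sub h3).congr_deriv ?_
    simp only [one_mul]
    norm_num
    ring
  have hanti : AntitoneOn φ (Set.Icc 0 1) := by
    refine antitoneOn_of_deriv_nonpos (convex_Icc 0 1)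
      (fun t _ => (hφ t).continuousAt.continuousWithinAt)
      (fun t _ => (hφ t).differentiableAt.differentiableWithinAt) ?_
    intro t ht
    rw [interior_Icc] at ht
    rw [(hφ t).deriv, ← inner_sub_left]
    have h1 := real_inner_le_norm (gradient f (x + t • v) - gradient f x) v
    have h2 := hL (x + t • v) x
    rw [add_sub_cancel_left, norm_smul, Real.norm_of_nonneg ht.1.le] at h2
    nlinarith [norm_nonneg v]
  have h := hanti (Set.left_mem_Icc.2 zero_le_one) (Set.right_mem_Icc.2 zero_le_one) zero_le_one
  have e1 : x + (1 : ℝ) • v = y := by simp [hv]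
  simp only [φ, zero_smul, add_zero, e1] at h
  linarith

theorem gradient_eq_zero_of_forall_le {xs : E} (hxs : ∀ y, f xs ≤ f y) : gradient f xs = 0 := by
  have h : IsLocalMin f xs := Filter.Eventually.of_forall hxs
  simp [gradient, h.fderiv_eq_zero]

/-- Cocoercivity of the gradient, obtained by comparing `f` with its tangent at `x` in the point
reached from `y` by a gradient step for `f - ⟪∇f x, ·⟫`. -/
theorem norm_gradient_sub_sq_le (hf : Differentiable ℝ f) (hL0 : 0 < L)
    (hc : StrongConvexOn Set.univ 0 f)
    (hL : ∀ x y, ‖gradient f x - gradient f y‖ ≤ L * ‖x - y‖) (x y : E) :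
    ‖gradient f y - gradient f x‖ ^ 2 ≤ L * inner ℝ (gradient f y - gradient f x) (y - x) := by
  have key : ∀ x y : E, f x + inner ℝ (gradient f x) (y - x)
      + ‖gradient f y - gradient f x‖ ^ 2 / (2 * L) ≤ f y := by
    intro x y
    set Δ := gradient f y - gradient f x with hΔ
    have h1 := hc.add_inner_gradient_le hf x (y - L⁻¹ • Δ)
    have h2 := le_add_inner_gradient hf hL y (y - L⁻¹ • Δ)
    have e1 : y - L⁻¹ • Δ - y = -(L⁻¹ • Δ) := by abel
    have e2 : y - L⁻¹ • Δ - x = (y - x) - L⁻¹ • Δ := by abel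
    have e3 : inner ℝ (gradient f y) Δ - inner ℝ (gradient f x) Δ = ‖Δ‖ ^ 2 := by
      rw [← inner_sub_left, ← hΔ, real_inner_self_eq_norm_sq]
    rw [e1, inner_neg_right, norm_neg, norm_smul, inner_smul_right,
      Real.norm_of_nonneg (inv_nonneg.2 hL0.le)] at h2
    rw [e2, inner_sub_right, inner_smul_right] at h1
    have e4 : L / 2 * (L⁻¹ * ‖Δ‖) ^ 2 = ‖Δ‖ ^ 2 / (2 * L) := by field_simp
    have e5 : L⁻¹ * inner ℝ (gradient f y) Δ - L⁻¹ * inner ℝ (gradient f x) Δ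
        = 2 * (‖Δ‖ ^ 2 / (2 * L)) := by
      rw [← mul_sub, e3]; field_simp
    linarith
  have h1 := key x y
  have h2 := key y x
  have e1 : inner ℝ (gradient f y) (x - y) = -inner ℝ (gradient f y) (y - x) := by
    rw [← inner_neg_right, neg_sub]
  rw [e1, norm_sub_rev] at h2
  rw [inner_sub_left]
  have e2 : ‖gradient f y - gradient f x‖ ^ 2
      = L * (2 * (‖gradient f y - gradient f x‖ ^ 2 / (2 * L))) := by field_simp
  rw [e2]
  exact mul_le_mul_of_nonneg_left (by linarith) hL0.le

theorem norm_gradient_sq_le (hf : Differentiable ℝ f) (hL0 : 0 < L)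
    (hL : ∀ x y, ‖gradient f x - gradient f y‖ ≤ L * ‖x - y‖) {xs : E} (hxs : ∀ y, f xs ≤ f y)
    (x : E) : ‖gradient f x‖ ^ 2 ≤ 2 * L * (f x - f xs) := by
  have h2 := le_add_inner_gradient hf hL x (x - L⁻¹ • gradient f x)
  have e1 : x - L⁻¹ • gradient f x - x = -(L⁻¹ • gradient f x) := by abel
  rw [e1, inner_neg_right, norm_neg, norm_smul, inner_smul_right,
    Real.norm_of_nonneg (inv_nonneg.2 hL0.le), real_inner_self_eq_norm_sq] at h2
  have h3 := hxs (x - L⁻¹ • gradient f x)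
  have e4 : L / 2 * (L⁻¹ * ‖gradient f x‖) ^ 2 = ‖gradient f x‖ ^ 2 / (2 * L) := by field_simp
  have e5 : L⁻¹ * ‖gradient f x‖ ^ 2 = 2 * (‖gradient f x‖ ^ 2 / (2 * L)) := by field_simp
  have h4 : ‖gradient f x‖ ^ 2 / (2 * L) ≤ f x - f xs := by linarith
  rw [div_le_iff₀ (by positivity)] at h4
  linarith

end Smooth

/-! ### One step of the noisy method -/

section Step

variable {E : Type*} [NormedAddCommGroup E] [InnerProductSpace ℝ E]

/-- The quadratic inequality behind the contraction factor `1 - s` of the noiseless method. -/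
theorem norm_extrapolation_sq_le {s : ℝ} (hs0 : 0 ≤ s) (hs1 : s ≤ 1) (z a : E) :
    ‖z + s ^ 2 • a‖ ^ 2 ≤ (1 - s) * (1 + s) ^ 2 * ‖z‖ ^ 2 + (1 - s) * s ^ 2 * ‖z - s • a‖ ^ 2
      + s ^ 3 * ‖z + a‖ ^ 2 := by
  -- The difference of the two sides is `s (1 - s²) ‖z - s a‖²`.
  have h : 0 ≤ s * (1 - s ^ 2) * ‖z - s • a‖ ^ 2 := by
    have : 0 ≤ 1 - s ^ 2 := by nlinarith
    positivity
  rw [norm_sub_sq_real, norm_smul, inner_smul_right, mul_pow, Real.norm_eq_abs, sq_abs] at *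
  rw [norm_add_sq_real, norm_add_sq_real, norm_smul, inner_smul_right, mul_pow, Real.norm_eq_abs,
    sq_abs]
  linarith

/-- Cauchy–Schwarz with weights adapted to the constant `12/5`. -/
theorem add_add_sq_le {x y r t : ℝ} (hy : y ^ 2 ≤ t) (hr : r ^ 2 ≤ 12 / 5 * t) :
    (x + y + r) ^ 2 ≤ 15 / 2 * (x ^ 2 + t) := by
  nlinarith [sq_nonneg (13 / 2 * x - (y + r)), sq_nonneg (3 / 2 * y - r)]

variable [CompleteSpace E] {f : E → ℝ} {μ L α s : ℝ} {xs : E}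

/-- A combination of a scaled gradient and a scaled distance to the minimizer. Strong convexity,
through the inner product of the two, makes the bound vanish in the limit `s → 1`. -/
theorem norm_gradient_sub_smul_sq_le (hf : Differentiable ℝ f) (hL0 : 0 < L)
    (hc : StrongConvexOn Set.univ μ f)
    (hL : ∀ x y, ‖gradient f x - gradient f y‖ ≤ L * ‖x - y‖) (hxs : ∀ y, f xs ≤ f y)
    (hα : 0 < α) (hαL : α * L ≤ 1) (hμL : μ ≤ L) (hs0 : 0 < s) (hs1 : s ≤ 1)
    (hs : s ^ 2 = α * μ) (x : E) :
    ‖(α * L * α) • gradient f x - s • (x - xs)‖ ^ 2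
      ≤ (2 - 2 * s) * (2 * α * (f x - f xs)) := by
  have h1 := hc.add_inner_gradient_le hf x xs
  have h2 := hc.add_inner_gradient_le hf xs x
  have h3 := norm_gradient_sq_le hf hL0 hL hxs x
  rw [gradient_eq_zero_of_forall_le hxs, inner_zero_left] at h2
  rw [← neg_sub x xs, inner_neg_right, norm_neg] at h1
  rw [norm_sub_sq_real, norm_smul, norm_smul, inner_smul_left, inner_smul_right, mul_pow, mul_pow,
    Real.norm_eq_abs, Real.norm_eq_abs, sq_abs, sq_abs]
  simp only [RCLike.conj_to_real]
  set G := ‖gradient f x‖ ^ 2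
  set A := ‖x - xs‖ ^ 2
  set I : ℝ := inner ℝ (gradient f x) (x - xs)
  set F := f x - f xs with hF
  set δ := α * L with hδ
  have hδ0 : 0 < δ := mul_pos hα hL0
  have hF0 : 0 ≤ F := sub_nonneg.2 (hxs x)
  have hsδ : s ^ 2 ≤ δ := by rw [hs]; exact mul_le_mul_of_nonneg_left hμL hα.le
  have hA : s ^ 2 * A ≤ 2 * α * F := by
    rw [hs]
    have : α * (μ / 2 * A) ≤ α * F := mul_le_mul_of_nonneg_left (by linarith) hα.le
    linarith
  have hG : (δ * α) ^ 2 * G ≤ δ ^ 3 * (2 * α * F) := by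
    have : (δ * α) ^ 2 * G ≤ (δ * α) ^ 2 * (2 * L * F) :=
      mul_le_mul_of_nonneg_left h3 (by positivity)
    calc _ ≤ _ := this
      _ = _ := by rw [hδ]; ring
  have hI : δ * s * (2 * α * F + s ^ 2 * A) ≤ 2 * (δ * α * (s * I)) := by
    have : 2 * α * (F + μ / 2 * A) ≤ 2 * α * I :=
      mul_le_mul_of_nonneg_left (by linarith) (by positivity)
    have := mul_le_mul_of_nonneg_left this (show 0 ≤ δ * s by positivity)
    rw [hs]
    linarith
  have hA' : (1 - δ * s) * (s ^ 2 * A) ≤ (1 - δ * s) * (2 * α * F) :=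
    mul_le_mul_of_nonneg_left hA (by nlinarith)
  have hcoef : 1 + δ ^ 3 - 2 * δ * s ≤ 2 - 2 * s := by
    have : 0 ≤ (1 - δ) * (1 + δ + δ ^ 2 - 2 * s) :=
      mul_nonneg (by linarith) (by nlinarith [sq_nonneg (1 - s), sq_nonneg δ])
    nlinarith
  have := mul_le_mul_of_nonneg_right hcoef (show 0 ≤ 2 * α * F by positivity)
  linarith

/-- The vector that multiplies the noise in the one-step expansion of the Lyapunov function. The
gradient at the extrapolated point `y` is compared with that at `x`, cocoercivity absorbing the
difference. -/
theorem norm_noise_direction_sq_le (hf : Differentiable ℝ f) (hL0 : 0 < L) (hμ : 0 < μ)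
    (hc : StrongConvexOn Set.univ μ f)
    (hL : ∀ x y, ‖gradient f x - gradient f y‖ ≤ L * ‖x - y‖) (hxs : ∀ y, f xs ≤ f y)
    (hα : 0 < α) (hαL : α * L ≤ 1) (hμL : μ ≤ L) (hs0 : 0 < s) (hs1 : s ≤ 1)
    (hs : s ^ 2 = α * μ) {x y z : E} (hy : (1 + s) • (y - x) = z - s • (x - xs)) :
    ‖z + s ^ 2 • (x - xs) - ((1 + s) * (α * L * α)) • gradient f y‖ ^ 2
      ≤ 15 / 2 * (2 * α) * (f x - f xs + 1 / (2 * α) * ‖z‖ ^ 2) := by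
  set a := x - xs with ha
  set F := f x - f xs with hF
  have hF0 : 0 ≤ F := sub_nonneg.2 (hxs x)
  set δ := α * L with hδ
  have hδ0 : 0 < δ := mul_pos hα hL0
  set ζ := z - s • a with hζ
  set u := (α * (1 + s)) • (gradient f y - gradient f x) with hu
  have hco : ‖u‖ ^ 2 ≤ δ * inner ℝ u ζ := by
    have h := norm_gradient_sub_sq_le hf hL0 (hc.mono hμ.le) hL x y
    have h' := mul_le_mul_of_nonneg_left h (show 0 ≤ (α * (1 + s)) ^ 2 by positivity)
    rw [hu, ← hy, norm_smul, inner_smul_left, inner_smul_right, mul_pow, Real.norm_eq_abs, sq_abs]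
    simp only [RCLike.conj_to_real]
    calc _ ≤ _ := h'
      _ = _ := by rw [hδ]; ring
  have hζu : ‖ζ - δ • u‖ ≤ ‖ζ‖ := by
    rw [← sq_le_sq₀ (norm_nonneg _) (norm_nonneg _), norm_sub_sq_real, norm_smul, inner_smul_right,
      mul_pow, Real.norm_eq_abs, sq_abs, real_inner_comm]
    have hin : 0 ≤ inner ℝ u ζ := nonneg_of_mul_nonneg_right ((sq_nonneg _).trans hco) hδ0
    have h1 : δ ^ 2 * ‖u‖ ^ 2 ≤ δ * inner ℝ u ζ := by
      have : δ ^ 2 * ‖u‖ ^ 2 ≤ 1 * ‖u‖ ^ 2 :=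
        mul_le_mul_of_nonneg_right (pow_le_one₀ hδ0.le hαL) (sq_nonneg _)
      linarith
    have h2 : 0 ≤ δ * inner ℝ u ζ := (sq_nonneg _).trans hco
    linarith
  have hdec : z + s ^ 2 • a - ((1 + s) * (δ * α)) • gradient f y
      = (ζ - δ • u) - (1 + s) • ((δ * α) • gradient f x - s • a) := by
    rw [hζ, hu]; module
  have hW := norm_gradient_sub_smul_sq_le hf hL0 hc hL hxs hα hαL hμL hs0 hs1 hs x
  rw [← hδ, ← ha, ← hF] at hW
  set W := ‖(δ * α) • gradient f x - s • a‖ with hWdef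
  have hnorm : ‖z + s ^ 2 • a - ((1 + s) * (δ * α)) • gradient f y‖
      ≤ ‖z‖ + s * ‖a‖ + (1 + s) * W := by
    rw [hdec]
    refine (norm_sub_le _ _).trans ?_
    rw [norm_smul, Real.norm_of_nonneg (by linarith : 0 ≤ 1 + s)]
    have h2 : ‖ζ‖ ≤ ‖z‖ + s * ‖a‖ := by
      rw [hζ]
      refine (norm_sub_le _ _).trans ?_
      rw [norm_smul, Real.norm_of_nonneg hs0.le]
    linarith
  have hA : (s * ‖a‖) ^ 2 ≤ 2 * α * F := by
    have h2 := hc.add_inner_gradient_le hf xs x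
    rw [gradient_eq_zero_of_forall_le hxs, inner_zero_left] at h2
    rw [mul_pow, hs]
    have : α * (μ / 2 * ‖a‖ ^ 2) ≤ α * F := mul_le_mul_of_nonneg_left (by linarith) hα.le
    linarith
  have hR : ((1 + s) * W) ^ 2 ≤ 12 / 5 * (2 * α * F) := by
    -- `(1 + s)² (2 - 2 s)` is largest at `s = 1/3`, where it equals `64/27 < 12/5`.
    have hm : (1 + s) ^ 2 * (2 - 2 * s) ≤ 12 / 5 := by
      nlinarith [mul_nonneg (sq_nonneg (s - 1 / 3)) (show 0 ≤ s + 5 / 3 by linarith)]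
    calc ((1 + s) * W) ^ 2 = (1 + s) ^ 2 * W ^ 2 := by ring
      _ ≤ (1 + s) ^ 2 * ((2 - 2 * s) * (2 * α * F)) :=
        mul_le_mul_of_nonneg_left hW (by positivity)
      _ = (1 + s) ^ 2 * (2 - 2 * s) * (2 * α * F) := by ring
      _ ≤ _ := mul_le_mul_of_nonneg_right hm (by positivity)
  calc _ ≤ (‖z‖ + s * ‖a‖ + (1 + s) * W) ^ 2 := pow_le_pow_left₀ (norm_nonneg _) hnorm 2
    _ ≤ 15 / 2 * (‖z‖ ^ 2 + 2 * α * F) := add_add_sq_le hA hR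
    _ = _ := by field_simp; ring

/-- Expansion of the Lyapunov function after one noisy step, around the gradient step from the
extrapolated point `y`; `z` is the vector whose norm enters the Lyapunov function. -/
theorem lyapunov_step_le (hf : Differentiable ℝ f)
    (hc : StrongConvexOn Set.univ μ f)
    (hL : ∀ x y, ‖gradient f x - gradient f y‖ ≤ L * ‖x - y‖)
    (hα : 0 < α) (hαL : α * L ≤ 1) (hs0 : 0 < s) (hs1 : s ≤ 1)
    (hs : s ^ 2 = α * μ) {x y z : E} (hy : (1 + s) • (y - x) = z - s • (x - xs)) (w : E) :
    f (y - α • (gradient f y + w)) - f xs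
        + 1 / (2 * α) * ‖y - α • (gradient f y + w) - xs - (1 - s) • (x - xs)‖ ^ 2
      ≤ (1 - s) * (f x - f xs + 1 / (2 * α) * ‖z‖ ^ 2)
        - (1 + s)⁻¹ *
          inner ℝ (z + s ^ 2 • (x - xs) - ((1 + s) * (α * L * α)) • gradient f y) w
        + (α * L * α / 2 + α / 2) * ‖w‖ ^ 2 := by
  set g := gradient f y with hg
  obtain ⟨a, ha⟩ : ∃ a, a = x - xs := ⟨_, rfl⟩
  rw [← ha] at hy ⊢
  have hs' : (1 + s) ≠ 0 := by linarith
  have hX : x - y = -((1 + s)⁻¹ • (z - s • a)) := by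
    rw [← hy, inv_smul_smul₀ hs', neg_sub]
  have hY : xs - y = -((1 + s)⁻¹ • (z + a)) := by
    rw [eq_neg_iff_add_eq_zero, ← smul_right_injective E hs' |>.eq_iff]
    simp only [smul_zero, smul_add, smul_inv_smul₀ hs']
    have : (1 + s) • (xs - y) = -((1 + s) • (y - x)) - (1 + s) • a := by rw [ha]; module
    rw [this, hy]; module
  obtain ⟨m, hm⟩ : ∃ m, m = (1 + s)⁻¹ • (z + s ^ 2 • a) := ⟨_, rfl⟩
  have hcomb : (1 - s) • (x - y) + s • (xs - y) = -m := by
    rw [hX, hY, hm]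
    module
  have hz' : y - α • (g + w) - xs - (1 - s) • a = m - α • (g + w) := by
    rw [← neg_neg m, ← hcomb, ha]; module
  have h1 := le_add_inner_gradient hf hL y (y - α • (g + w))
  have h2 := hc.add_inner_gradient_le hf y x
  have h3 := hc.add_inner_gradient_le hf y xs
  rw [← hg] at h1 h2 h3
  have h23 : (1 - s) * inner ℝ g (x - y) + s * inner ℝ g (xs - y) = -inner ℝ g m := by
    rw [← inner_smul_right, ← inner_smul_right, ← inner_add_right, hcomb, inner_neg_right]
  have hquad : ‖m‖ ^ 2 ≤ (1 - s) * ‖z‖ ^ 2 + (1 - s) * s ^ 2 * ‖x - y‖ ^ 2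
      + s ^ 3 * ‖xs - y‖ ^ 2 := by
    have h := norm_extrapolation_sq_le hs0.le hs1 z a
    rw [hX, hY, hm]
    simp only [norm_neg, norm_smul, mul_pow, norm_inv, Real.norm_eq_abs, sq_abs, inv_pow]
    rw [inv_mul_le_iff₀ (by positivity)]
    refine h.trans (le_of_eq ?_)
    field_simp
  have hquad' : 1 / (2 * α) * ‖m‖ ^ 2 ≤ (1 - s) * (1 / (2 * α) * ‖z‖ ^ 2)
      + (1 - s) * (μ / 2 * ‖x - y‖ ^ 2) + s * (μ / 2 * ‖xs - y‖ ^ 2) := by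
    have h := mul_le_mul_of_nonneg_left hquad (show 0 ≤ 1 / (2 * α) by positivity)
    refine h.trans (le_of_eq ?_)
    rw [show s ^ 3 = s * s ^ 2 by ring, hs]
    field_simp
  have e1 : y - α • (g + w) - y = -(α • (g + w)) := by abel
  rw [e1, inner_neg_right, norm_neg, norm_smul, mul_pow, Real.norm_eq_abs, sq_abs,
    inner_smul_right, norm_add_sq_real, inner_add_right, real_inner_self_eq_norm_sq] at h1
  have e2 : inner ℝ (z + s ^ 2 • a - ((1 + s) * (α * L * α)) • g) w
      = (1 + s) * (inner ℝ m w - α * L * α * inner ℝ g w) := by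
    have : z + s ^ 2 • a - ((1 + s) * (α * L * α)) • g = (1 + s) • (m - (α * L * α) • g) := by
      rw [smul_sub, hm, smul_inv_smul₀ hs', smul_smul]
    rw [this, inner_smul_left, inner_sub_left, inner_smul_left]
    simp only [RCLike.conj_to_real]
  rw [hz', e2, inv_mul_cancel_left₀ hs', norm_sub_sq_real, norm_smul, mul_pow, Real.norm_eq_abs,
    sq_abs, inner_smul_right, norm_add_sq_real, inner_add_right, real_inner_comm g m]
  have h2' := mul_le_mul_of_nonneg_left h2 (sub_nonneg.2 hs1)
  have h3' := mul_le_mul_of_nonneg_left h3 hs0.le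
  have hgg : 0 ≤ (1 - α * L) * (α / 2 * ‖g‖ ^ 2) :=
    mul_nonneg (by linarith) (by positivity)
  have e3 : 1 / (2 * α) * (‖m‖ ^ 2 - 2 * (α * (inner ℝ g m + inner ℝ m w))
      + α ^ 2 * (‖g‖ ^ 2 + 2 * inner ℝ g w + ‖w‖ ^ 2))
      = 1 / (2 * α) * ‖m‖ ^ 2 - (inner ℝ g m + inner ℝ m w)
      + α / 2 * (‖g‖ ^ 2 + 2 * inner ℝ g w + ‖w‖ ^ 2) := by
    field_simp
  rw [e3]
  linarith

/-- One noisy step from `(x, x')` to `(y - α (∇f(y) + w), x)`. The cross term between noise and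
state is split by Young's inequality with the weight `2 D α / (s (1 + s)²)`,
`D = 5 - 2 s + s²`. -/
theorem lyapunov_step_le_of_noise (hf : Differentiable ℝ f) (hL0 : 0 < L) (hμ : 0 < μ)
    (hc : StrongConvexOn Set.univ μ f)
    (hL : ∀ x y, ‖gradient f x - gradient f y‖ ≤ L * ‖x - y‖) (hxs : ∀ y, f xs ≤ f y)
    (hα : 0 < α) (hαL : α * L ≤ 1) (hμL : μ ≤ L) (hs0 : 0 < s) (hs1 : s ≤ 1)
    (hs : s ^ 2 = α * μ) {x y z : E} (hy : (1 + s) • (y - x) = z - s • (x - xs)) (w : E) :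
    f (y - α • (gradient f y + w)) - f xs
        + 1 / (2 * α) * ‖y - α • (gradient f y + w) - xs - (1 - s) • (x - xs)‖ ^ 2
      ≤ (1 - s + s * (8 - s + s ^ 2) / (4 * (5 - 2 * s + s ^ 2)))
          * (f x - f xs + 1 / (2 * α) * ‖z‖ ^ 2)
        + (2 * (5 - 2 * s + s ^ 2) * α / (s * (1 + s) ^ 2) + α * L * α / 2 + α / 2)
          * ‖w‖ ^ 2 := by
  have h1 := lyapunov_step_le hf hc hL hα hαL hs0 hs1 hs hy w
  have h2 := norm_noise_direction_sq_le hf hL0 hμ hc hL hxs hα hαL hμL hs0 hs1 hs hy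
  set n := z + s ^ 2 • (x - xs) - ((1 + s) * (α * L * α)) • gradient f y
  have hV0 : 0 ≤ f x - f xs + 1 / (2 * α) * ‖z‖ ^ 2 :=
    add_nonneg (sub_nonneg.2 (hxs x)) (by positivity)
  set V := f x - f xs + 1 / (2 * α) * ‖z‖ ^ 2
  set D := 5 - 2 * s + s ^ 2 with hD
  have hD0 : 0 < D := by nlinarith
  have hin : -((1 + s)⁻¹ * inner ℝ n w) ≤ (1 + s)⁻¹ * (‖n‖ * ‖w‖) := by
    have := (abs_le.1 (abs_real_inner_le_norm n w)).1
    rw [← mul_neg]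
    exact mul_le_mul_of_nonneg_left (by linarith) (by positivity)
  have hyoung : (1 + s)⁻¹ * (‖n‖ * ‖w‖)
      ≤ 2 * D * α / (s * (1 + s) ^ 2) * ‖w‖ ^ 2 + s / (8 * D * α) * ‖n‖ ^ 2 := by
    have h : 0 ≤ s / (8 * D * α) * (4 * D * α / (s * (1 + s)) * ‖w‖ - ‖n‖) ^ 2 := by positivity
    have e : s / (8 * D * α) * (4 * D * α / (s * (1 + s)) * ‖w‖ - ‖n‖) ^ 2
        = 2 * D * α / (s * (1 + s) ^ 2) * ‖w‖ ^ 2 + s / (8 * D * α) * ‖n‖ ^ 2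
          - (1 + s)⁻¹ * (‖n‖ * ‖w‖) := by
      field_simp
      ring
    linarith
  have hn : s / (8 * D * α) * ‖n‖ ^ 2 ≤ s * (8 - s + s ^ 2) / (4 * D) * V := by
    have h3 := mul_le_mul_of_nonneg_left h2 (show 0 ≤ s / (8 * D * α) by positivity)
    have e : s / (8 * D * α) * (15 / 2 * (2 * α) * V) = s * (15 / 2) / (4 * D) * V := by
      field_simp
      ring
    refine h3.trans (e.le.trans (mul_le_mul_of_nonneg_right ?_ hV0))
    -- `15/2 ≤ 8 - s + s²`, the minimum of the right-hand side being `31/4`.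
    gcongr
    nlinarith [sq_nonneg (s - 1 / 2)]
  linarith

end Step

/-! ### The constants of Nesterov's method -/

section Parameters

variable {α μ L : ℝ}

theorem sqrt_mul_pos_lt_one (hα : 0 < α) (hμ : 0 < μ) (hμL : μ < L) (hαL : α * L ≤ 1) :
    0 < √(α * μ) ∧ √(α * μ) < 1 ∧ √(α * μ) ^ 2 = α * μ := by
  have h : 0 < α * μ := mul_pos hα hμ
  refine ⟨Real.sqrt_pos.2 h, ?_, Real.sq_sqrt h.le⟩
  rw [Real.sqrt_lt' one_pos]
  nlinarith

theorem nagS1_eq (hα : 0 < α) (hμ : 0 < μ) :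
    nagS1 α μ = 2 * (5 - 2 * √(α * μ) + √(α * μ) ^ 2) * α / (√(α * μ) * (1 + √(α * μ)) ^ 2) := by
  have h1 : √(α * μ) = √α * √μ := Real.sqrt_mul hα.le _
  have ha := Real.sqrt_pos.2 hα
  have hm := Real.sqrt_pos.2 hμ
  have h2 : √α ^ 2 = α := Real.sq_sqrt hα.le
  have h3 : α * μ = √(α * μ) ^ 2 := (Real.sq_sqrt (mul_pos hα hμ).le).symm
  unfold nagS1
  rw [div_eq_div_iff (by positivity) (by positivity)]
  generalize hs : √(α * μ) = s at *
  rw [h3]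
  have : s * √α = α * √μ := by rw [h1, ← h2]; simp only [Real.sqrt_sq ha.le]; ring
  linear_combination 2 * (5 - 2 * s + s ^ 2) * (1 + s) ^ 2 * this

/-- The contribution of `s₂` to `p` and `q` depends on `√(α μ)` alone. -/
theorem div_nagS2_eq (hα : 0 < α) (hμ : 0 < μ) (hL : 0 < L) :
    4 * L ^ 3 * α ^ 2 / (2 * μ * nagS2 α μ L)
      = √(α * μ) * (1 + √(α * μ)) ^ 2 / (4 * (4 + (1 - √(α * μ)) ^ 2)) := by
  have h1 : √(α * μ) = √α * √μ := Real.sqrt_mul hα.le _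
  have ha := Real.sqrt_pos.2 hα
  have hm := Real.sqrt_pos.2 hμ
  have h2 : √α ^ 2 = α := Real.sq_sqrt hα.le
  have h3 : √μ ^ 2 = μ := Real.sq_sqrt hμ.le
  have hs0 : 0 ≤ √(α * μ) := Real.sqrt_nonneg _
  unfold nagS2
  generalize √(α * μ) = s at *
  have hD : 4 + (1 - s) ^ 2 ≠ 0 := by positivity
  have hs1 : 1 + s ≠ 0 := by positivity
  rw [h1] at *
  field_simp
  ring_nf
  nlinarith

theorem nagS2_pos (hα : 0 < α) (hμ : 0 < μ) (hL : 0 < L) : 0 < nagS2 α μ L := by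
  unfold nagS2
  have hs0 : 0 ≤ √(α * μ) := Real.sqrt_nonneg _
  have := Real.sqrt_pos.2 hα
  have := Real.sqrt_pos.2 hμ
  positivity

theorem nagP_eq (hα : 0 < α) (hμ : 0 < μ) (hL : 0 < L) :
    nagP α μ L = 1 - √(α * μ) + √(α * μ) * (8 - √(α * μ) + √(α * μ) ^ 2)
      / (4 * (5 - 2 * √(α * μ) + √(α * μ) ^ 2)) := by
  have hs2 : α * μ = √(α * μ) ^ 2 := (Real.sq_sqrt (mul_pos hα hμ).le).symm
  have hs0 : 0 < √(α * μ) := Real.sqrt_pos.2 (mul_pos hα hμ)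
  unfold nagP nagNu
  rw [div_nagS2_eq hα hμ hL, nagS1_eq hα hμ]
  generalize √(α * μ) = s at *
  have hD : 5 - 2 * s + s ^ 2 ≠ 0 := by nlinarith [sq_nonneg (1 - s)]
  have hs1 : 1 + s ≠ 0 := by positivity
  have e1 : 4 + (1 - s) ^ 2 = 5 - 2 * s + s ^ 2 := by ring
  rw [e1, ← mul_pow, mul_assoc 2 α μ, hs2]
  field_simp
  ring_nf
  rw [show μ = s ^ 2 / α by rw [← hs2]; field_simp]
  field_simp
  ring

theorem nagQ_eq (hα : 0 < α) (hμ : 0 < μ) (hL : 0 < L) :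
    nagQ α μ L = √(α * μ) * (1 - √(α * μ)) * (2 - √(α * μ))
      / (4 * (5 - 2 * √(α * μ) + √(α * μ) ^ 2)) := by
  have hs0 : 0 < √(α * μ) := Real.sqrt_pos.2 (mul_pos hα hμ)
  unfold nagQ nagNu
  rw [mul_div_right_comm (4 * L ^ 3 * α ^ 2), div_nagS2_eq hα hμ hL, nagS1_eq hα hμ]
  generalize √(α * μ) = s at *
  have hD : 5 - 2 * s + s ^ 2 ≠ 0 := by nlinarith [sq_nonneg (1 - s)]
  have hs1 : 1 + s ≠ 0 := by positivity
  have e1 : 4 + (1 - s) ^ 2 = 5 - 2 * s + s ^ 2 := by ring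
  rw [e1]
  field_simp
  ring

theorem le_nagR (hα : 0 < α) (hμ : 0 < μ) (hL : 0 < L) :
    2 * (5 - 2 * √(α * μ) + √(α * μ) ^ 2) * α / (√(α * μ) * (1 + √(α * μ)) ^ 2)
      + α * L * α / 2 + α / 2 ≤ nagR α μ L := by
  have h := nagS2_pos hα hμ hL
  unfold nagR
  rw [nagS1_eq hα hμ]
  have e : L * α ^ 2 * (2 + nagS2 α μ L) / (2 * nagS2 α μ L)
      = α * L * α / 2 + L * α ^ 2 / nagS2 α μ L := by
    field_simp
    ring
  have : 0 ≤ L * α ^ 2 / nagS2 α μ L := by positivity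
  linarith

theorem nagP_add_nagQ (hα : 0 < α) (hμ : 0 < μ) (hL : 0 < L) :
    nagP α μ L + nagQ α μ L = 1 - √(α * μ) / 2 := by
  rw [nagP_eq hα hμ hL, nagQ_eq hα hμ hL]
  generalize √(α * μ) = s
  have hD : 5 - 2 * s + s ^ 2 ≠ 0 := by nlinarith [sq_nonneg (1 - s)]
  have e : s * (8 - s + s ^ 2) + s * (1 - s) * (2 - s) = s / 2 * (4 * (5 - 2 * s + s ^ 2)) := by
    ring
  rw [add_assoc, ← add_div, e, mul_div_cancel_right₀ _ (mul_ne_zero four_ne_zero hD)]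
  ring

theorem nagP_pos (hα : 0 < α) (hμ : 0 < μ) (hμL : μ < L) (hαL : α * L ≤ 1) :
    0 < nagP α μ L := by
  obtain ⟨hs0, hs1, -⟩ := sqrt_mul_pos_lt_one hα hμ hμL hαL
  rw [nagP_eq hα hμ (hμ.trans hμL)]
  have h1 : 0 < 8 - √(α * μ) + √(α * μ) ^ 2 := by nlinarith
  have h2 : 0 < 5 - 2 * √(α * μ) + √(α * μ) ^ 2 := by nlinarith
  have h3 : 0 < 1 - √(α * μ) := by linarith
  positivity

theorem nagQ_nonneg (hα : 0 < α) (hμ : 0 < μ) (hμL : μ < L) (hαL : α * L ≤ 1) :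
    0 ≤ nagQ α μ L := by
  obtain ⟨hs0, hs1, -⟩ := sqrt_mul_pos_lt_one hα hμ hμL hαL
  rw [nagQ_eq hα hμ (hμ.trans hμL)]
  have h1 : 0 < 2 - √(α * μ) := by linarith
  have h2 : 0 < 5 - 2 * √(α * μ) + √(α * μ) ^ 2 := by nlinarith
  have h3 : 0 < 1 - √(α * μ) := by linarith
  positivity

theorem nagPt_posSemidef (hα : 0 < α) : (nagPt α μ).PosSemidef :=
  (Matrix.posSemidef_vecMulVec_self_star (R := ℝ) ![1, -(1 - √(α * μ))]).smul (by positivity)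

theorem rTilde_nagPt (hα : 0 < α) (hs : √(α * μ) < 1) : rTilde (nagPt α μ) = 0 := by
  have hs' : 1 - √(α * μ) ≠ 0 := by linarith
  have h00 : nagPt α μ 0 0 = 1 / (2 * α) * (1 * 1) := rfl
  have h01 : nagPt α μ 0 1 = 1 / (2 * α) * (1 * -(1 - √(α * μ))) := rfl
  have h11 : nagPt α μ 1 1 = 1 / (2 * α) * (-(1 - √(α * μ)) * -(1 - √(α * μ))) := rfl
  have hne : nagPt α μ 1 1 ≠ 0 := by
    rw [h11, neg_mul_neg]
    positivity
  rw [rTilde, if_pos hne, h00, h01, h11]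
  field_simp
  ring

/-- The Lyapunov function of the method: the matrix has rank one, so that the quadratic form is a
single square. -/
theorem lyapunov_nagPt {d : ℕ} (f : EuclideanSpace ℝ (Fin d) → ℝ)
    (xs : EuclideanSpace ℝ (Fin d)) (ξ : EuclideanSpace ℝ (Fin d) × EuclideanSpace ℝ (Fin d)) :
    lyapunov f xs 1 (nagPt α μ) ξ
      = f ξ.1 - f xs + 1 / (2 * α) * ‖ξ.1 - xs - (1 - √(α * μ)) • (ξ.2 - xs)‖ ^ 2 := by
  rw [norm_sub_sq_real, norm_smul, inner_smul_right, mul_pow, Real.norm_eq_abs, sq_abs]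
  simp only [lyapunov, nagPt, Fin.sum_univ_two, Matrix.smul_apply, Matrix.vecMulVec_apply,
    smul_eq_mul, Matrix.cons_val_zero, Matrix.cons_val_one, real_inner_self_eq_norm_sq,
    real_inner_comm (ξ.1 - xs) (ξ.2 - xs)]
  ring

end Parameters

/-- One step of the method decreases its Lyapunov function, up to the squared noise norm. -/
theorem lyapunov_state_succ_le {d : ℕ} {f : EuclideanSpace ℝ (Fin d) → ℝ} {μ L α : ℝ}
    (hμ : 0 < μ) (hμL : μ < L) (hf : StronglyConvexSmooth μ L f)
    {xs : EuclideanSpace ℝ (Fin d)} (hxs : ∀ y, f xs ≤ f y) (hα : 0 < α) (hαL : α * L ≤ 1)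
    (x₀ : EuclideanSpace ℝ (Fin d)) (u : ℕ → EuclideanSpace ℝ (Fin d)) (k : ℕ) :
    lyapunov f xs 1 (nagPt α μ) (state f α (nagNu α μ) (nagNu α μ) x₀ u (k + 1))
      ≤ nagP α μ L * lyapunov f xs 1 (nagPt α μ) (state f α (nagNu α μ) (nagNu α μ) x₀ u k)
        + nagR α μ L * ‖u (k + 1)‖ ^ 2 := by
  have hL := hμ.trans hμL
  obtain ⟨hs0, hs1, hs⟩ := sqrt_mul_pos_lt_one hα hμ hμL hαL
  rw [lyapunov_nagPt, lyapunov_nagPt, nagP_eq hα hμ hL]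
  have hr := mul_le_mul_of_nonneg_right (le_nagR hα hμ hL) (sq_nonneg ‖u (k + 1)‖)
  simp only [state]
  have hν : (1 + √(α * μ)) * nagNu α μ = 1 - √(α * μ) := by
    unfold nagNu
    field_simp
  generalize nagNu α μ = ν at *
  generalize (state f α ν ν x₀ u k).1 = x
  generalize (state f α ν ν x₀ u k).2 = x'
  generalize √(α * μ) = s at *
  set y := x + ν • (x - x') with hy
  have hy' : (1 + s) • (y - x) = x - xs - (1 - s) • (x' - xs) - s • (x - xs) := by
    rw [hy, add_sub_cancel_left, smul_smul, hν]
    module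
  have h := lyapunov_step_le_of_noise (hf.contDiff.differentiable one_ne_zero) hL hμ
    hf.strongConvex hf.smooth hxs hα hαL hμL.le hs0 hs1.le hs hy' (u (k + 1))
  have e : x - α • (gradient f y + u (k + 1)) + ν • (x - x')
      = y - α • (gradient f y + u (k + 1)) := by
    rw [hy]
    abel
  rw [e]
  linarith

/-! ### The rate `λ₊` -/

section LambdaPlus

variable {p q : ℝ}

theorem lambdaPlus_sq (hq : 0 ≤ q) : lambdaPlus p q * (lambdaPlus p q - p) = q := by
  have h : √(p ^ 2 + 4 * q) ^ 2 = p ^ 2 + 4 * q := Real.sq_sqrt (by positivity)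
  unfold lambdaPlus
  linear_combination h / 4

theorem le_lambdaPlus (hq : 0 ≤ q) : p ≤ lambdaPlus p q := by
  have h : p ≤ √(p ^ 2 + 4 * q) := Real.le_sqrt_of_sq_le (by linarith)
  unfold lambdaPlus
  linarith

theorem lambdaPlus_lt_one (hq : 0 ≤ q) (hpq : p + q < 1) : lambdaPlus p q < 1 := by
  have h : √(p ^ 2 + 4 * q) < 2 - p := by
    rw [Real.sqrt_lt' (by linarith)]
    nlinarith
  unfold lambdaPlus
  linarith

theorem J_pos (hq : 0 ≤ q) : 0 < J p q := by
  have := le_lambdaPlus (p := p) hq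
  exact one_div_pos.2 (by linarith)

theorem J_le_one (hq : 0 ≤ q) : J p q ≤ 1 := by
  have := le_lambdaPlus (p := p) hq
  rw [J, div_le_one (by linarith)]
  linarith

theorem one_sub_add_eq (hq : 0 ≤ q) : 1 - (p + q) = (1 - lambdaPlus p q) / J p q := by
  have h := lambdaPlus_sq (p := p) hq
  rw [J, div_div_eq_mul_div, div_one]
  linear_combination h

end LambdaPlus

/-! ### Summing the Lyapunov recursion -/

section Sums

variable {p q : ℝ}

/-- Exchange of summation in a double sum of geometric weights, stated without division. -/
theorem sum_pow_mul_eq (l : ℝ) (B : ℕ → ℝ) (N : ℕ) :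
    (1 - l) * ∑ k ∈ Finset.range (N + 1), ∑ j ∈ Finset.Icc 1 k, l ^ (k - j) * B j
      = ∑ j ∈ Finset.Icc 1 N, (1 - l ^ (N - j + 1)) * B j := by
  have key : ∀ N : ℕ, (1 - l) * ∑ k ∈ Finset.range (N + 1), ∑ j ∈ Finset.Icc 1 k, l ^ (k - j) * B j
      + l * ∑ j ∈ Finset.Icc 1 N, l ^ (N - j) * B j = ∑ j ∈ Finset.Icc 1 N, B j := by
    intro N
    induction N with
    | zero => simp
    | succ N ih =>
      rw [Finset.sum_range_succ _ (N + 1), Finset.sum_Icc_succ_top (by omega) B,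
        Finset.sum_Icc_succ_top (by omega) (fun j => l ^ (N + 1 - j) * B j), ← ih]
      have : ∑ j ∈ Finset.Icc 1 N, l ^ (N + 1 - j) * B j
          = l * ∑ j ∈ Finset.Icc 1 N, l ^ (N - j) * B j := by
        rw [Finset.mul_sum]
        refine Finset.sum_congr rfl fun j hj => ?_
        rw [Nat.succ_sub (Finset.mem_Icc.1 hj).2, pow_succ]
        ring
      rw [this, Nat.sub_self, pow_zero]
      ring
  rw [eq_sub_of_add_eq (key N), Finset.mul_sum, ← Finset.sum_sub_distrib]
  refine Finset.sum_congr rfl fun j _ => ?_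
  ring

/-- The potential `V k + (λ₊ - p) V (k - 1)`, with `V (-1) = V 0`, contracts with the factor
`λ₊`. -/
theorem potential_le {V B : ℕ → ℝ} (hq : 0 ≤ q) (hp : 0 ≤ p)
    (h0 : V 1 ≤ p * V 0 + q * V 0 + B 1)
    (h : ∀ k, V (k + 2) ≤ p * V (k + 1) + q * V k + B (k + 2)) (N : ℕ) :
    V (N + 1) + (lambdaPlus p q - p) * V N
      ≤ lambdaPlus p q ^ (N + 1) * (V 0 / J p q)
        + ∑ j ∈ Finset.Icc 1 (N + 1), lambdaPlus p q ^ (N + 1 - j) * B j := by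
  have hl := lambdaPlus_sq (p := p) hq
  have hl0 : 0 ≤ lambdaPlus p q := hp.trans (le_lambdaPlus hq)
  have hJ : V 0 / J p q = (1 + lambdaPlus p q - p) * V 0 := by
    rw [J, div_div_eq_mul_div, div_one, mul_comm]
  rw [hJ]
  generalize lambdaPlus p q = l at *
  induction N with
  | zero =>
    simp only [zero_add, pow_one, Finset.Icc_self, Finset.sum_singleton, Nat.sub_self, pow_zero,
      one_mul]
    have : q * V 0 = l * (l - p) * V 0 := by rw [hl]
    linarith
  | succ N ih =>
    rw [Finset.sum_Icc_succ_top (by omega)]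
    have e : ∑ j ∈ Finset.Icc 1 (N + 1), l ^ (N + 1 + 1 - j) * B j
        = l * ∑ j ∈ Finset.Icc 1 (N + 1), l ^ (N + 1 - j) * B j := by
      rw [Finset.mul_sum]
      refine Finset.sum_congr rfl fun j hj => ?_
      rw [Nat.succ_sub (Finset.mem_Icc.1 hj).2, pow_succ]
      ring
    rw [e, Nat.sub_self, pow_zero, one_mul, pow_succ]
    have h1 := mul_le_mul_of_nonneg_left ih hl0
    have h2 := h N
    have : q * V N = l * (l - p) * V N := by rw [hl]
    linarith

/-- Sum of the contracting potentials up to time `N`. -/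
theorem sum_potential_le {V B : ℕ → ℝ} (hq : 0 ≤ q) (hp : 0 ≤ p) (hpq : p + q < 1)
    (h0 : V 1 ≤ p * V 0 + q * V 0 + B 1)
    (h : ∀ k, V (k + 2) ≤ p * V (k + 1) + q * V k + B (k + 2)) (N : ℕ) :
    ∑ k ∈ Finset.range (N + 1), V k + (lambdaPlus p q - p) * (V 0 + ∑ k ∈ Finset.range N, V k)
      ≤ (1 - lambdaPlus p q ^ (N + 1)) / (1 - lambdaPlus p q) * (V 0 / J p q)
        + ∑ j ∈ Finset.Icc 1 N,
          (1 - lambdaPlus p q ^ (N - j + 1)) / (1 - lambdaPlus p q) * B j := by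
  have hl1 := lambdaPlus_lt_one hq hpq
  have hpot := potential_le hq hp h0 h
  have hJ : V 0 / J p q = (1 + lambdaPlus p q - p) * V 0 := by
    rw [J, div_div_eq_mul_div, div_one, mul_comm]
  have hdouble := sum_pow_mul_eq (lambdaPlus p q) B N
  have hgeom := geom_sum_eq hl1.ne (N + 1)
  generalize lambdaPlus p q = l at *
  have hl : 1 - l ≠ 0 := by linarith
  have e1 : ∑ j ∈ Finset.Icc 1 N, (1 - l ^ (N - j + 1)) / (1 - l) * B j
      = ∑ k ∈ Finset.range (N + 1), ∑ j ∈ Finset.Icc 1 k, l ^ (k - j) * B j := by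
    rw [eq_comm, ← mul_right_inj' hl, hdouble, Finset.mul_sum]
    refine Finset.sum_congr rfl fun j _ => ?_
    field_simp
  have e2 : (1 - l ^ (N + 1)) / (1 - l) = ∑ k ∈ Finset.range (N + 1), l ^ k := by
    rw [hgeom, ← neg_div_neg_eq]
    ring
  rw [e1, e2, Finset.sum_mul, ← Finset.sum_add_distrib, Finset.sum_range_succ' V,
    Finset.sum_range_succ' (fun k => l ^ k * (V 0 / J p q) + _)]
  have hsum : ∑ k ∈ Finset.range N, (V (k + 1) + (l - p) * V k)
      ≤ ∑ k ∈ Finset.range N, (l ^ (k + 1) * (V 0 / J p q)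
        + ∑ j ∈ Finset.Icc 1 (k + 1), l ^ (k + 1 - j) * B j) :=
    Finset.sum_le_sum fun k _ => hpot k
  rw [Finset.sum_add_distrib, ← Finset.mul_sum] at hsum
  have e3 : Finset.Icc 1 0 = (∅ : Finset ℕ) := rfl
  simp only [e3, Finset.sum_empty, pow_zero, add_zero, one_mul]
  linarith

/-- First summed bound: the delayed terms of the potentials are dropped, except for `V 0`. -/
theorem sum_lyapunov_le {V B : ℕ → ℝ} (hq : 0 ≤ q) (hp : 0 ≤ p) (hpq : p + q < 1)
    (hV : ∀ k, 0 ≤ V k) (h0 : V 1 ≤ p * V 0 + q * V 0 + B 1)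
    (h : ∀ k, V (k + 2) ≤ p * V (k + 1) + q * V k + B (k + 2)) (K : ℕ) :
    ∑ k ∈ Finset.range (K + 1), V k
      ≤ 1 / J p q * (((1 - lambdaPlus p q ^ (K + 1)) / (1 - lambdaPlus p q) - 1 + J p q) * V 0)
        + ∑ j ∈ Finset.Icc 1 K, aCoef p q j K / J p q * B j := by
  have hs := sum_potential_le hq hp hpq h0 h K
  have hl := le_lambdaPlus (p := p) hq
  have hJ := J_pos (p := p) hq
  have hJ' : 1 / J p q = 1 + lambdaPlus p q - p := by rw [J, one_div_one_div]
  have ha : ∀ j, aCoef p q j K / J p q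
      = (1 - lambdaPlus p q ^ (K - j + 1)) / (1 - lambdaPlus p q) := by
    intro j
    rw [aCoef, one_sub_add_eq hq, div_div_eq_mul_div, div_right_comm,
      mul_div_cancel_right₀ _ hJ.ne']
  simp only [ha]
  have h1 : 0 ≤ (lambdaPlus p q - p) * ∑ k ∈ Finset.range K, V k :=
    mul_nonneg (sub_nonneg.2 hl) (Finset.sum_nonneg fun k _ => hV k)
  have e : 1 / J p q * (((1 - lambdaPlus p q ^ (K + 1)) / (1 - lambdaPlus p q) - 1 + J p q) * V 0)
      = (1 - lambdaPlus p q ^ (K + 1)) / (1 - lambdaPlus p q) * (V 0 / J p q)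
        - (1 / J p q - 1) * V 0 := by
    generalize (1 - lambdaPlus p q ^ (K + 1)) / (1 - lambdaPlus p q) = G
    field_simp
    ring
  rw [e, hJ']
  linarith

/-- Second summed bound: the potentials are summed up to time `K + 1`, and the last value of `V`
is dropped. -/
theorem sum_lyapunov_le' {V B : ℕ → ℝ} (hq : 0 ≤ q) (hp : 0 ≤ p) (hpq : p + q < 1)
    (hV : ∀ k, 0 ≤ V k) (h0 : V 1 ≤ p * V 0 + q * V 0 + B 1)
    (h : ∀ k, V (k + 2) ≤ p * V (k + 1) + q * V k + B (k + 2)) (K : ℕ) :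
    ∑ k ∈ Finset.range (K + 1), V k
      ≤ ((1 - lambdaPlus p q ^ (K + 1 + 1)) / (1 - lambdaPlus p q) - 1 + J p q) * V 0
        + ∑ j ∈ Finset.Icc 1 (K + 1), aCoef p q j (K + 1) * B j := by
  have hs := sum_potential_le hq hp hpq h0 h (K + 1)
  have hJ := J_pos (p := p) hq
  have hJ' : lambdaPlus p q - p = 1 / J p q - 1 := by rw [J, one_div_one_div]; ring
  have ha : ∀ j, aCoef p q j (K + 1)
      = J p q * ((1 - lambdaPlus p q ^ (K + 1 - j + 1)) / (1 - lambdaPlus p q)) := by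
    intro j
    rw [aCoef, one_sub_add_eq hq, div_div_eq_mul_div, mul_comm, mul_div_assoc]
  simp only [ha, mul_assoc]
  rw [← Finset.mul_sum]
  rw [hJ', Finset.sum_range_succ] at hs
  generalize (∑ j ∈ Finset.Icc 1 (K + 1), _ : ℝ) = T at *
  generalize (1 - lambdaPlus p q ^ (K + 1 + 1)) / (1 - lambdaPlus p q) = G at *
  have h1 := mul_le_mul_of_nonneg_left hs hJ.le
  have h2 := mul_nonneg hJ.le (hV (K + 1))
  generalize (∑ k ∈ Finset.range (K + 1), V k : ℝ) = S at *
  have e1 : J p q * (S + V (K + 1) + (1 / J p q - 1) * (V 0 + S))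
      = J p q * V (K + 1) + S + V 0 - J p q * V 0 := by
    field_simp
    ring
  have e2 : J p q * (G * (V 0 / J p q) + T) = G * V 0 + J p q * T := by
    field_simp
  linarith

theorem aCoef_nonneg (hq : 0 ≤ q) (hp : 0 ≤ p) (hpq : p + q < 1) (j K : ℕ) :
    0 ≤ aCoef p q j K := by
  have hl1 := lambdaPlus_lt_one hq hpq
  have hl0 : 0 ≤ lambdaPlus p q := hp.trans (le_lambdaPlus hq)
  exact div_nonneg (sub_nonneg.2 (pow_le_one₀ hl0 hl1.le)) (by linarith)

theorem aCoef_le (hq : 0 ≤ q) (hp : 0 ≤ p) (hpq : p + q < 1) (j K : ℕ) :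
    aCoef p q j K ≤ 1 / (1 - (p + q)) := by
  have hl0 : 0 ≤ lambdaPlus p q := hp.trans (le_lambdaPlus hq)
  have : 0 < 1 - (p + q) := by linarith
  unfold aCoef
  gcongr
  have := pow_nonneg hl0 (K - j + 1)
  linarith

end Sums

/-! ### Exponential moments of the noise -/

section Noise

/-- A bound on the conditional probability of `S` given `m` can be integrated against
`m`-measurable weights. -/
theorem setLIntegral_le_of_condExp_indicator_le {Ω : Type*} {m m0 : MeasurableSpace Ω}
    {P : Measure Ω} [IsFiniteMeasure P] (hm : m ≤ m0) {S : Set Ω} (hS : MeasurableSet S) {b : ℝ}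
    (h : P[S.indicator (fun _ => (1 : ℝ)) | m] ≤ᵐ[P] fun _ => b) {g : Ω → ENNReal}
    (hg : Measurable[m] g) :
    ∫⁻ ω in S, g ω ∂P ≤ ENNReal.ofReal b * ∫⁻ ω, g ω ∂P := by
  have hle : (P.restrict S).trim hm ≤ ENNReal.ofReal b • P.trim hm := by
    refine @Measure.le_intro _ m _ _ fun B hB _ => ?_
    rw [trim_measurableSet_eq hm hB, Measure.smul_apply, trim_measurableSet_eq hm hB,
      Measure.restrict_apply (hm _ hB), smul_eq_mul]
    have hint : Integrable (S.indicator fun _ => (1 : ℝ)) P :=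
      (integrable_const (1 : ℝ)).indicator hS
    have h1 : ∫ ω in B, (P[S.indicator (fun _ => (1 : ℝ)) | m]) ω ∂P ≤ ∫ ω in B, b ∂P :=
      setIntegral_mono_ae integrable_condExp.integrableOn (integrable_const b).integrableOn h
    rw [setIntegral_condExp hm hint hB, setIntegral_indicator hS, setIntegral_const,
      setIntegral_const, smul_eq_mul, smul_eq_mul, mul_one, mul_comm] at h1
    rw [← ofReal_measureReal (μ := P) (s := B ∩ S), ← ofReal_measureReal (μ := P) (s := B),
      ← ENNReal.ofReal_mul' measureReal_nonneg]
    exact ENNReal.ofReal_le_ofReal h1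
  calc ∫⁻ ω in S, g ω ∂P = ∫⁻ ω, g ω ∂(P.restrict S).trim hm := (lintegral_trim hm hg).symm
    _ ≤ ∫⁻ ω, g ω ∂(ENNReal.ofReal b • P.trim hm) := lintegral_mono' hle le_rfl
    _ = _ := by rw [lintegral_smul_measure, lintegral_trim hm hg, smul_eq_mul]

/-- Layer cake: a sub-Gaussian tail of `X` under a measure `Q` controls the exponential moments of
`X ^ 2`. -/
theorem lintegral_exp_mul_sq_le {Ω : Type*} [MeasurableSpace Ω] {Q : Measure Ω} {X : Ω → ℝ}
    (hX : Measurable X) (hX0 : ∀ ω, 0 ≤ X ω) {σ τ : ℝ} (hσ : 0 < σ) (hτ0 : 0 ≤ τ)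
    (hτ : 2 * σ ^ 2 * τ < 1)
    (hQ : ∀ t : ℝ, 0 ≤ t →
      Q {ω | t ≤ X ω} ≤ ENNReal.ofReal (2 * Real.exp (-t ^ 2 / (2 * σ ^ 2))) * Q Set.univ) :
    ∫⁻ ω, ENNReal.ofReal (Real.exp (τ * X ω ^ 2)) ∂Q
      ≤ ENNReal.ofReal ((1 + 2 * σ ^ 2 * τ) / (1 - 2 * σ ^ 2 * τ)) * Q Set.univ := by
  have hprim : ∀ A : ℝ, ∫ t in (0 : ℝ)..A, τ * Real.exp (τ * t) = Real.exp (τ * A) - 1 := by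
    intro A
    have := intervalIntegral.integral_eq_sub_of_hasDerivAt (a := 0) (b := A)
      (f := fun t => Real.exp (τ * t)) (f' := fun t => τ * Real.exp (τ * t))
      (fun t _ => by
        have := ((hasDerivAt_id t).const_mul τ).exp
        simpa [mul_comm] using this)
      (Continuous.intervalIntegrable (by fun_prop) _ _)
    rwa [mul_zero, Real.exp_zero] at this
  have hlayer := lintegral_comp_eq_lintegral_meas_le_mul Q (f := fun ω => X ω ^ 2)
    (g := fun t => τ * Real.exp (τ * t))
    (Filter.Eventually.of_forall fun ω => sq_nonneg _) (by fun_prop)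
    (fun t _ => Continuous.intervalIntegrable (by fun_prop) _ _)
    (Filter.Eventually.of_forall fun t => by positivity)
  have hlam : τ - 1 / (2 * σ ^ 2) < 0 := by
    rw [sub_neg, lt_div_iff₀ (by positivity)]
    linarith
  have htail : ∫⁻ t in Set.Ioi (0 : ℝ), Q {ω | t ≤ X ω ^ 2} * ENNReal.ofReal (τ * Real.exp (τ * t))
      ≤ ENNReal.ofReal (2 * τ * (2 * σ ^ 2) / (1 - 2 * σ ^ 2 * τ)) * Q Set.univ := by
    calc _ ≤ ∫⁻ t in Set.Ioi (0 : ℝ),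
          ENNReal.ofReal (2 * τ * Real.exp ((τ - 1 / (2 * σ ^ 2)) * t)) * Q Set.univ := by
          refine setLIntegral_mono' measurableSet_Ioi fun t ht => ?_
          have ht0 : 0 ≤ t := le_of_lt ht
          have hset : {ω | t ≤ X ω ^ 2} = {ω | √t ≤ X ω} := by
            ext ω
            exact (Real.sqrt_le_left (hX0 ω)).symm
          rw [hset]
          refine (mul_le_mul_left (hQ (√t) (Real.sqrt_nonneg t)) _).trans (le_of_eq ?_)
          rw [mul_right_comm, ← ENNReal.ofReal_mul (by positivity), Real.sq_sqrt ht0]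
          congr 2
          rw [mul_mul_mul_comm, ← Real.exp_add]
          congr 2
          ring
      _ = ENNReal.ofReal (∫ t in Set.Ioi (0 : ℝ),
          2 * τ * Real.exp ((τ - 1 / (2 * σ ^ 2)) * t)) * Q Set.univ := by
          rw [lintegral_mul_const _ (by fun_prop), ofReal_integral_eq_lintegral_ofReal]
          · exact (integrableOn_exp_mul_Ioi hlam 0).const_mul _
          · exact Filter.Eventually.of_forall fun t => by positivity
      _ = _ := by
          rw [integral_const_mul, integral_exp_mul_Ioi hlam]
          congr 2
          have : 1 - 2 * σ ^ 2 * τ ≠ 0 := by linarith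
          have h' : τ - 1 / (2 * σ ^ 2) = -((1 - 2 * σ ^ 2 * τ) / (2 * σ ^ 2)) := by
            field_simp
            ring
          rw [h', mul_zero, Real.exp_zero]
          field_simp
  have hsplit : ∀ ω, ENNReal.ofReal (Real.exp (τ * X ω ^ 2))
      = 1 + ENNReal.ofReal (∫ t in (0 : ℝ)..X ω ^ 2, τ * Real.exp (τ * t)) := by
    intro ω
    have h1 : 1 ≤ Real.exp (τ * X ω ^ 2) := Real.one_le_exp (by positivity)
    rw [hprim, ← ENNReal.ofReal_one, ← ENNReal.ofReal_add zero_le_one (by linarith)]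
    congr 1
    ring
  simp only [hsplit]
  rw [lintegral_add_left measurable_const, hlayer, lintegral_const, one_mul]
  calc _ ≤ Q Set.univ + ENNReal.ofReal (2 * τ * (2 * σ ^ 2) / (1 - 2 * σ ^ 2 * τ)) * Q Set.univ :=
        add_le_add le_rfl htail
    _ = ENNReal.ofReal (1 + 2 * τ * (2 * σ ^ 2) / (1 - 2 * σ ^ 2 * τ)) * Q Set.univ := by
        rw [ENNReal.ofReal_add zero_le_one (div_nonneg (by positivity) (by linarith)),
          ENNReal.ofReal_one, add_mul, one_mul]
    _ = _ := by
        congr 2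
        have : 1 - 2 * σ ^ 2 * τ ≠ 0 := by linarith
        rw [eq_div_iff this, add_mul, div_mul_cancel₀ _ this]
        ring

theorem iterateSigma_mono {d : ℕ} {Ω : Type*} {f : EuclideanSpace ℝ (Fin d) → ℝ} {α β ν : ℝ}
    {x₀ : EuclideanSpace ℝ (Fin d)} {w : ℕ → Ω → EuclideanSpace ℝ (Fin d)} {k l : ℕ}
    (h : k ≤ l) : iterateSigma f α β ν x₀ w k ≤ iterateSigma f α β ν x₀ w l :=
  biSup_mono fun _ hj => Finset.range_mono (Nat.succ_le_succ h) hj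

theorem measurable_ofReal_exp_sum_norm_sq {Ω ι F : Type*} [MeasurableSpace Ω]
    [NormedAddCommGroup F] [MeasurableSpace F] [BorelSpace F] {s : Finset ι} {u : ι → Ω → F}
    (hu : ∀ j ∈ s, Measurable (u j)) (τ : ι → ℝ) :
    Measurable fun ω => ENNReal.ofReal (Real.exp (∑ j ∈ s, τ j * ‖u j ω‖ ^ 2)) :=
  (Real.measurable_exp.comp (Finset.measurable_fun_sum _ fun j hj =>
    ((hu j hj).norm.pow_const 2).const_mul (τ j))).ennreal_ofReal

variable {d : ℕ} {Ω : Type*} [MeasurableSpace Ω] {P : Measure Ω}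
  {f : EuclideanSpace ℝ (Fin d) → ℝ} {α β ν : ℝ} {x₀ : EuclideanSpace ℝ (Fin d)}
  {w : ℕ → Ω → EuclideanSpace ℝ (Fin d)} {σ : ℝ}

theorem measurable_state (hf : ContDiff ℝ 1 f) (hw : ∀ k, Measurable (w (k + 1))) (k : ℕ) :
    Measurable fun ω => state f α β ν x₀ (fun j => w j ω) k := by
  have hg : Measurable (gradient f) := by
    have : Continuous (gradient f) :=
      (InnerProductSpace.toDual ℝ _).symm.continuous.comp (hf.continuous_fderiv one_ne_zero)
    exact this.measurable
  induction k with
  | zero => exact measurable_const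
  | succ k ih =>
    have h1 := ih.fst
    have h2 := ih.snd
    have h3 := hw k
    simp only [state]
    fun_prop

theorem iterateSigma_le (hf : ContDiff ℝ 1 f) (hw : ∀ k, Measurable (w (k + 1))) (k : ℕ) :
    iterateSigma f α β ν x₀ w k ≤ ‹MeasurableSpace Ω› :=
  iSup₂_le fun j _ => (measurable_state hf hw j).fst.comap_le

/-- The exponential moment of the squared noise norm, conditionally on the past: the layer cake
bound is applied to `P` reweighted by the density `g`. -/
theorem SubGaussianNoise.lintegral_mul_exp_le [IsProbabilityMeasure P] (hf : ContDiff ℝ 1 f)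
    (hw : SubGaussianNoise P f α β ν x₀ w σ) (hσ : 0 < σ) {τ : ℝ} (hτ0 : 0 ≤ τ)
    (hτ : 2 * σ ^ 2 * τ < 1) (k : ℕ) {g : Ω → ENNReal}
    (hg : Measurable[iterateSigma f α β ν x₀ w k] g) :
    ∫⁻ ω, g ω * ENNReal.ofReal (Real.exp (τ * ‖w (k + 1) ω‖ ^ 2)) ∂P
      ≤ ENNReal.ofReal ((1 + 2 * σ ^ 2 * τ) / (1 - 2 * σ ^ 2 * τ)) * ∫⁻ ω, g ω ∂P := by
  have hm := iterateSigma_le (α := α) (β := β) (ν := ν) (x₀ := x₀) hf hw.measurable k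
  have hgm : Measurable g := hg.mono hm le_rfl
  have hX : Measurable fun ω => ‖w (k + 1) ω‖ := (hw.measurable k).norm
  have h := lintegral_exp_mul_sq_le (Q := P.withDensity g) hX (fun ω => norm_nonneg _) hσ hτ0 hτ
    (fun t ht => by
      have hS : MeasurableSet {ω | t ≤ ‖w (k + 1) ω‖} := measurableSet_le measurable_const hX
      rw [withDensity_apply _ hS, withDensity_apply _ MeasurableSet.univ, setLIntegral_univ]
      exact setLIntegral_le_of_condExp_indicator_le hm hS (hw.tail k t ht) hg)
  rwa [lintegral_withDensity_eq_lintegral_mul _ hgm (by fun_prop),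
    withDensity_apply _ MeasurableSet.univ, setLIntegral_univ] at h

/-- Conditioning successively on the iterates bounds the joint exponential moment of the squared
noise norms by a product. -/
theorem SubGaussianNoise.lintegral_exp_sum_le [IsProbabilityMeasure P] (hf : ContDiff ℝ 1 f)
    (hw : SubGaussianNoise P f α β ν x₀ w σ) (hσ : 0 < σ) {τ : ℕ → ℝ} (hτ0 : ∀ j, 0 ≤ τ j)
    (hτ : ∀ j, 2 * σ ^ 2 * τ j < 1) (N : ℕ) :
    ∫⁻ ω, ENNReal.ofReal (Real.exp (∑ j ∈ Finset.Icc 1 N, τ j * ‖w j ω‖ ^ 2)) ∂P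
      ≤ ENNReal.ofReal (∏ j ∈ Finset.Icc 1 N,
        (1 + 2 * σ ^ 2 * τ j) / (1 - 2 * σ ^ 2 * τ j)) := by
  induction N with
  | zero => simp
  | succ N ih =>
    have hg : Measurable[iterateSigma f α β ν x₀ w N]
        fun ω => ENNReal.ofReal (Real.exp (∑ j ∈ Finset.Icc 1 N, τ j * ‖w j ω‖ ^ 2)) := by
      refine @measurable_ofReal_exp_sum_norm_sq _ _ _ (iterateSigma f α β ν x₀ w N) _ _ _ _ _
        (fun j hj => ?_) τ
      obtain ⟨i, rfl⟩ : ∃ i, j = i + 1 := ⟨j - 1, by have := (Finset.mem_Icc.1 hj).1; omega⟩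
      exact (hw.adapted i).mono (iterateSigma_mono (Finset.mem_Icc.1 hj).2) le_rfl
    have h := hw.lintegral_mul_exp_le hf hσ (hτ0 (N + 1)) (hτ (N + 1)) N hg
    rw [Finset.prod_Icc_succ_top (by omega), mul_comm, ENNReal.ofReal_mul
      (div_nonneg (by have := hτ0 (N + 1); positivity) (by linarith [hτ (N + 1)]))]
    calc _ = ∫⁻ ω, ENNReal.ofReal (Real.exp (∑ j ∈ Finset.Icc 1 N, τ j * ‖w j ω‖ ^ 2))
          * ENNReal.ofReal (Real.exp (τ (N + 1) * ‖w (N + 1) ω‖ ^ 2)) ∂P := by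
          refine lintegral_congr fun ω => ?_
          rw [Finset.sum_Icc_succ_top (by omega), Real.exp_add,
            ENNReal.ofReal_mul (Real.exp_pos _).le]
      _ ≤ _ := h
      _ ≤ _ := mul_le_mul_right ih _

end Noise

/-! ### The risk bound -/

section Risk

/-- Passage from a pathwise bound on the cumulative cost by weighted squared noise norms to a
bound on the risk-sensitive cost. -/
theorem riskCost_le_of_cumulativeCost_le {d : ℕ} {Ω : Type*} [MeasurableSpace Ω] {P : Measure Ω}
    [IsProbabilityMeasure P] {f : EuclideanSpace ℝ (Fin d) → ℝ} {α β ν : ℝ}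
    {x₀ xs : EuclideanSpace ℝ (Fin d)} {w : ℕ → Ω → EuclideanSpace ℝ (Fin d)} {σ : ℝ}
    (hf : ContDiff ℝ 1 f) (hw : SubGaussianNoise P f α β ν x₀ w σ) (hσ : 0 < σ) {K N : ℕ}
    {θ C : ℝ} (hθ : 0 < θ) {ρ : ℕ → ℝ} (hρ0 : ∀ j, 0 ≤ ρ j) (hρ : ∀ j, θ * ρ j < 1)
    (hS : ∀ ω, cumulativeCost f α β ν x₀ xs w K ω
      ≤ C + ∑ j ∈ Finset.Icc 1 N, ρ j * ‖w j ω‖ ^ 2) :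
    riskCost P f α β ν x₀ xs w σ K θ
      ≤ ((1 / (K + 1 : ℝ) * (C + 2 * σ ^ 2 / θ *
        ∑ j ∈ Finset.Icc 1 N, Real.log ((1 + θ * ρ j) / (1 - θ * ρ j))) : ℝ) : EReal) := by
  set τ : ℕ → ℝ := fun j => θ / (2 * σ ^ 2) * ρ j with hτ
  have hτ' : ∀ j, 2 * σ ^ 2 * τ j = θ * ρ j := fun j => by
    simp only [hτ]
    field_simp
  have hmom := hw.lintegral_exp_sum_le hf hσ (τ := τ)
    (fun j => mul_nonneg (by positivity) (hρ0 j)) (fun j => by rw [hτ']; exact hρ j) N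
  simp only [hτ'] at hmom
  have hfac : ∀ j, 0 < (1 + θ * ρ j) / (1 - θ * ρ j) := fun j =>
    div_pos (by have := mul_nonneg hθ.le (hρ0 j); linarith) (by linarith [hρ j])
  have hprod : ∏ j ∈ Finset.Icc 1 N, (1 + θ * ρ j) / (1 - θ * ρ j)
      = Real.exp (∑ j ∈ Finset.Icc 1 N, Real.log ((1 + θ * ρ j) / (1 - θ * ρ j))) := by
    rw [Real.exp_sum]
    exact Finset.prod_congr rfl fun j _ => (Real.exp_log (hfac j)).symm
  set Λ := ∑ j ∈ Finset.Icc 1 N, Real.log ((1 + θ * ρ j) / (1 - θ * ρ j))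
  have hE : ∫⁻ ω, ENNReal.ofReal
      (Real.exp (θ / (2 * σ ^ 2) * cumulativeCost f α β ν x₀ xs w K ω)) ∂P
      ≤ ENNReal.ofReal (Real.exp (θ / (2 * σ ^ 2) * C + Λ)) := by
    calc _ ≤ ∫⁻ ω, ENNReal.ofReal (Real.exp (θ / (2 * σ ^ 2) * C))
          * ENNReal.ofReal (Real.exp (∑ j ∈ Finset.Icc 1 N, τ j * ‖w j ω‖ ^ 2)) ∂P := by
          refine lintegral_mono fun ω => ?_
          rw [← ENNReal.ofReal_mul (Real.exp_pos _).le, ← Real.exp_add]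
          refine ENNReal.ofReal_le_ofReal (Real.exp_le_exp.2 ?_)
          have h := mul_le_mul_of_nonneg_left (hS ω) (show 0 ≤ θ / (2 * σ ^ 2) by positivity)
          rw [mul_add, Finset.mul_sum] at h
          simpa only [hτ, mul_assoc] using h
      _ = ENNReal.ofReal (Real.exp (θ / (2 * σ ^ 2) * C))
          * ∫⁻ ω, ENNReal.ofReal (Real.exp (∑ j ∈ Finset.Icc 1 N, τ j * ‖w j ω‖ ^ 2)) ∂P :=
          lintegral_const_mul' _ _ ENNReal.ofReal_ne_top
      _ ≤ ENNReal.ofReal (Real.exp (θ / (2 * σ ^ 2) * C)) * ENNReal.ofReal (Real.exp Λ) :=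
          mul_le_mul_right (hmom.trans_eq (by rw [hprod])) _
      _ = _ := by rw [← ENNReal.ofReal_mul (Real.exp_pos _).le, ← Real.exp_add]
  have hlog : ENNReal.log (ENNReal.ofReal (Real.exp (θ / (2 * σ ^ 2) * C + Λ)))
      = ((θ / (2 * σ ^ 2) * C + Λ : ℝ) : EReal) := by
    rw [ENNReal.log_ofReal_of_pos (Real.exp_pos _), Real.log_exp]
  have hK : (0 : ℝ) < K + 1 := by positivity
  have hc0 : (0 : EReal) ≤ ((2 * σ ^ 2 / ((K + 1 : ℝ) * θ) : ℝ) : EReal) := by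
    rw [EReal.coe_nonneg]
    positivity
  have h := mul_le_mul_of_nonneg_left (ENNReal.log_monotone hE) hc0
  rw [hlog, ← EReal.coe_mul] at h
  unfold riskCost
  refine h.trans (le_of_eq ?_)
  congr 1
  field_simp

theorem cBar_of_lt {p q r c σ V₀ θ : ℝ} {K : ℕ} (h : √θ * hInfBar p q r c < 1) :
    cBar p q r c σ V₀ K θ
      = ((((1 - lambdaPlus p q ^ (K + 1)) / (1 - lambdaPlus p q) - 1 + J p q) * V₀
        + 2 * σ ^ 2 * c / θ * ∑ j ∈ Finset.Icc 1 K,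
          Real.log ((c + r * θ * aCoef p q j K) / (c - r * θ * aCoef p q j K)) : ℝ) : EReal) := by
  rw [cBar, cHat, if_pos h, ← EReal.coe_add]

theorem cBar_of_not_lt {p q r c σ V₀ θ : ℝ} {K : ℕ} (h : ¬ √θ * hInfBar p q r c < 1) :
    cBar p q r c σ V₀ K θ = ⊤ := by
  rw [cBar, cHat, if_neg h]
  exact EReal.coe_add_top _

/-- Finiteness of the risk bound at `θ` keeps `r θ a_{j,K}` below one. -/
theorem mul_aCoef_lt_one {p q r θ : ℝ} (hq : 0 ≤ q) (hp : 0 ≤ p) (hpq : p + q < 1)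
    (hr : 0 ≤ r) (hθ : 0 < θ) (h : √θ * hInfBar p q r 1 < 1) (j K : ℕ) :
    θ * (r * aCoef p q j K) < 1 := by
  have hpq' : 0 < 1 - (p + q) := by linarith
  rw [hInfBar, ← Real.sqrt_mul hθ.le, Real.sqrt_lt' one_pos, one_pow, div_one] at h
  refine lt_of_le_of_lt ?_ h
  rw [mul_comm (1 / (1 - (p + q)))]
  gcongr
  exact aCoef_le hq hp hpq j K

/-- A Lyapunov function that dominates the suboptimality gap and contracts with the factor `p` up to
squared noise norms yields the risk bound; since `q V ≥ 0`, the two-step recursion with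
coefficients `p` and `q` holds as well. -/
theorem riskCost_le_riskBound {d : ℕ} {Ω : Type*} [MeasurableSpace Ω] {P : Measure Ω}
    [IsProbabilityMeasure P] {f : EuclideanSpace ℝ (Fin d) → ℝ} {α β ν : ℝ}
    {x₀ xs : EuclideanSpace ℝ (Fin d)} {w : ℕ → Ω → EuclideanSpace ℝ (Fin d)} {σ L p q r : ℝ}
    {Pt : Matrix (Fin 2) (Fin 2) ℝ}
    (hf : ContDiff ℝ 1 f) (hw : SubGaussianNoise P f α β ν x₀ w σ) (hσ : 0 < σ)
    (hPt : rTilde Pt = 0) (hq : 0 ≤ q) (hp : 0 ≤ p) (hpq : p + q < 1) (hr : 0 ≤ r)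
    {V : (EuclideanSpace ℝ (Fin d) × EuclideanSpace ℝ (Fin d)) → ℝ}
    (hV : ∀ ξ, 0 ≤ V ξ) (hfV : ∀ ξ, f ξ.1 - f xs ≤ V ξ)
    (hstep : ∀ (u : ℕ → EuclideanSpace ℝ (Fin d)) k,
      V (state f α β ν x₀ u (k + 1)) ≤ p * V (state f α β ν x₀ u k) + r * ‖u (k + 1)‖ ^ 2)
    (K : ℕ) {θ : ℝ} (hθ : 0 < θ) :
    riskCost P f α β ν x₀ xs w σ K θ ≤ riskBound L p q r 1 Pt σ (V (x₀, x₀)) K θ := by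
  simp only [riskBound, hPt, mul_zero, add_zero, one_mul]
  split_ifs with hlt
  swap
  · exact le_top
  have hJ := J_pos (p := p) hq
  have hcost : ∀ ω, cumulativeCost f α β ν x₀ xs w K ω
      ≤ ∑ k ∈ Finset.range (K + 1), V (state f α β ν x₀ (fun j => w j ω) k) := fun ω =>
    Finset.sum_le_sum fun k _ => hfV _
  have hrec0 : ∀ ω, V (state f α β ν x₀ (fun j => w j ω) 1)
      ≤ p * V (state f α β ν x₀ (fun j => w j ω) 0)
        + q * V (state f α β ν x₀ (fun j => w j ω) 0) + r * ‖w 1 ω‖ ^ 2 := fun ω => by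
    have h1 := hstep (fun j => w j ω) 0
    have h2 := mul_nonneg hq (hV (state f α β ν x₀ (fun j => w j ω) 0))
    simp only [zero_add] at h1
    linarith
  have hrec : ∀ ω k, V (state f α β ν x₀ (fun j => w j ω) (k + 2))
      ≤ p * V (state f α β ν x₀ (fun j => w j ω) (k + 1))
        + q * V (state f α β ν x₀ (fun j => w j ω) k) + r * ‖w (k + 2) ω‖ ^ 2 := fun ω k => by
    have h1 := hstep (fun j => w j ω) (k + 1)
    have h2 := mul_nonneg hq (hV (state f α β ν x₀ (fun j => w j ω) k))
    linarith
  have hK : (0 : ℝ) < K + 1 := by positivity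
  have hK' : (0 : ℝ) < 1 / (K + 1) := by positivity
  rcases min_choice (((1 / J p q : ℝ) : EReal) * cBar p q r 1 σ (V (x₀, x₀)) K (θ / J p q))
    (cBar p q r 1 σ (V (x₀, x₀)) (K + 1) θ) with hmin | hmin <;> rw [hmin]
  · by_cases hlt' : √(θ / J p q) * hInfBar p q r 1 < 1
    · have hρ0 : ∀ j, 0 ≤ r * (aCoef p q j K / J p q) := fun j =>
        mul_nonneg hr (div_nonneg (aCoef_nonneg hq hp hpq j K) hJ.le)
      have hρ : ∀ j, θ * (r * (aCoef p q j K / J p q)) < 1 := fun j => by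
        have h := mul_aCoef_lt_one hq hp hpq hr (div_pos hθ hJ) hlt' j K
        calc _ = θ / J p q * (r * aCoef p q j K) := by ring
          _ < 1 := h
      have hS : ∀ ω, cumulativeCost f α β ν x₀ xs w K ω
          ≤ 1 / J p q * (((1 - lambdaPlus p q ^ (K + 1)) / (1 - lambdaPlus p q) - 1 + J p q)
              * V (x₀, x₀))
            + ∑ j ∈ Finset.Icc 1 K, r * (aCoef p q j K / J p q) * ‖w j ω‖ ^ 2 := fun ω => by
        refine (hcost ω).trans ((sum_lyapunov_le hq hp hpq (fun k => hV _)
          (B := fun j => r * ‖w j ω‖ ^ 2) (hrec0 ω) (hrec ω) K).trans (le_of_eq ?_))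
        exact congrArg₂ _ rfl (Finset.sum_congr rfl fun j _ => by ring)
      have h := riskCost_le_of_cumulativeCost_le hf hw hσ hθ hρ0 hρ hS
      have e : ∀ j, θ * (r * (aCoef p q j K / J p q)) = r * (θ / J p q) * aCoef p q j K :=
        fun j => by ring
      simp only [e] at h
      refine h.trans (le_of_eq ?_)
      rw [cBar_of_lt hlt', ← EReal.coe_mul, ← EReal.coe_mul, mul_add (1 / J p q)]
      congr 3
      field_simp
    · rw [cBar_of_not_lt hlt', EReal.coe_mul_top_of_pos (one_div_pos.2 hJ),
        EReal.coe_mul_top_of_pos hK']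
      exact le_top
  · have hρ0 : ∀ j, 0 ≤ r * aCoef p q j (K + 1) := fun j =>
      mul_nonneg hr (aCoef_nonneg hq hp hpq j (K + 1))
    have hS : ∀ ω, cumulativeCost f α β ν x₀ xs w K ω
        ≤ ((1 - lambdaPlus p q ^ (K + 1 + 1)) / (1 - lambdaPlus p q) - 1 + J p q) * V (x₀, x₀)
          + ∑ j ∈ Finset.Icc 1 (K + 1), r * aCoef p q j (K + 1) * ‖w j ω‖ ^ 2 := fun ω => by
      refine (hcost ω).trans ((sum_lyapunov_le' hq hp hpq (fun k => hV _)
        (B := fun j => r * ‖w j ω‖ ^ 2) (hrec0 ω) (hrec ω) K).trans (le_of_eq ?_))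
      exact congrArg₂ _ rfl (Finset.sum_congr rfl fun j _ => by ring)
    have h := riskCost_le_of_cumulativeCost_le hf hw hσ hθ hρ0
      (fun j => mul_aCoef_lt_one hq hp hpq hr hθ hlt j (K + 1)) hS
    have e : ∀ j, θ * (r * aCoef p q j (K + 1)) = r * θ * aCoef p q j (K + 1) := fun j => by ring
    simp only [e] at h
    refine h.trans (le_of_eq ?_)
    rw [cBar_of_lt hlt, ← EReal.coe_mul, mul_one]

end Risk

end GMM

theorem mainTheorem12 {d : ℕ} {Ω : Type*} [MeasurableSpace Ω] (P : Measure Ω)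
    [IsProbabilityMeasure P]
    (μ L : ℝ) (hμ : 0 < μ) (hμL : μ < L)
    (f : EuclideanSpace ℝ (Fin d) → ℝ) (hf : GMM.StronglyConvexSmooth μ L f)
    (xs : EuclideanSpace ℝ (Fin d)) (hxs : ∀ y, f xs ≤ f y)
    (α : ℝ) (hα : 0 < α) (hαL : α ≤ 1 / L)
    (x₀ : EuclideanSpace ℝ (Fin d))
    (w : ℕ → Ω → EuclideanSpace ℝ (Fin d)) (σ : ℝ) (hσ : 0 < σ)
    (hw : GMM.SubGaussianNoise P f α (GMM.nagNu α μ) (GMM.nagNu α μ) x₀ w σ) :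
    (GMM.nagPt α μ).PosSemidef ∧
    GMM.rTilde (GMM.nagPt α μ) = 0 ∧
    0 ≤ GMM.nagP α μ L ∧ 0 ≤ GMM.nagQ α μ L ∧ GMM.nagP α μ L + GMM.nagQ α μ L < 1 ∧
    GMM.lambdaPlus (GMM.nagP α μ L) (GMM.nagQ α μ L) ∈ Set.Ico (0 : ℝ) 1 ∧
    GMM.J (GMM.nagP α μ L) (GMM.nagQ α μ L) ∈ Set.Ioc (0 : ℝ) 1 ∧
    ∀ K : ℕ, 1 ≤ K → ∀ θ : ℝ, 0 < θ →
      GMM.riskCost P f α (GMM.nagNu α μ) (GMM.nagNu α μ) x₀ xs w σ K θ ≤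
        GMM.riskBound L (GMM.nagP α μ L) (GMM.nagQ α μ L) (GMM.nagR α μ L) 1 (GMM.nagPt α μ) σ
          (GMM.lyapunov f xs 1 (GMM.nagPt α μ) (x₀, x₀)) K θ := by
  have hL := hμ.trans hμL
  have hαL' : α * L ≤ 1 := (le_div_iff₀ hL).1 hαL
  obtain ⟨hs0, hs1, -⟩ := GMM.sqrt_mul_pos_lt_one hα hμ hμL hαL'
  have hPt := GMM.rTilde_nagPt hα hs1
  have hp := (GMM.nagP_pos hα hμ hμL hαL').le
  have hq := GMM.nagQ_nonneg hα hμ hμL hαL'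
  have hpq : GMM.nagP α μ L + GMM.nagQ α μ L < 1 := by
    rw [GMM.nagP_add_nagQ hα hμ hL]
    linarith
  have hr : 0 ≤ GMM.nagR α μ L := by
    refine le_trans ?_ (GMM.le_nagR hα hμ hL)
    have : 0 < 5 - 2 * √(α * μ) + √(α * μ) ^ 2 := by nlinarith
    positivity
  have hfV : ∀ ξ, f ξ.1 - f xs ≤ GMM.lyapunov f xs 1 (GMM.nagPt α μ) ξ := fun ξ => by
    rw [GMM.lyapunov_nagPt]
    exact le_add_of_nonneg_right (by positivity)
  refine ⟨GMM.nagPt_posSemidef hα, hPt, hp, hq, hpq,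
    ⟨hp.trans (GMM.le_lambdaPlus hq), GMM.lambdaPlus_lt_one hq hpq⟩,
    ⟨GMM.J_pos hq, GMM.J_le_one hq⟩, fun K _ θ hθ => ?_⟩
  exact GMM.riskCost_le_riskBound hf.contDiff hw hσ hPt hq hp hpq hr
    (fun ξ => (sub_nonneg.2 (hxs _)).trans (hfV ξ)) hfV
    (GMM.lyapunov_state_succ_le hμ hμL hf hxs hα hαL' x₀) K hθ
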